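/- Let $P$ be a poset with $n$ elements, labelled bijectively (in an arbitrary way) by $1,\dots,n$, let $\lambda=(\lambda_1,\dots,\lambda_r)\vdash n$ be a partition with parts $\lambda_1\ge\dots\ge\lambda_r>0$, and let $\mathrm{inc}(P)$ be the incomparability graph of $P$ (vertices: the elements of $P$; edges: the incomparable pairs). For a graph $G$ let $X_G=\sum_\kappa\prod_v x_{\kappa(v)}$, summed over all proper colorings $\kappa$ of $G$ with positive integers, be its chromatic symmetric function. For $\mu\vdash n$ let $\epsilon^\mu$ and $\eta^\mu$ be the characters of $S_n$ induced from the sign and the trivial character of the Young subgroup $S_\mu$, extended linearly to $\mathbb{Q}[S_n]$, and let $m_\mu$ be the monomial symmetric function. For $g\in\mathbb{Q}[S_n]$ put $Y(g)=\sum_{\mu\vdash n}\epsilon^\mu(g)\,m_\mu$. There exist elements $g\in\mathbb{Q}[S_n]$ with $Y(g)=X_{\mathrm{inc}(P)}$, and the number $\eta^\lambda(\mathrm{inc}(P)):=\eta^\lambda(g)$ is the same for all such $g$; it is also the coefficient of $m_\lambda$ in $\omega X_{\mathrm{inc}(P)}$, where $\omega$ is the algebra automorphism of the ring of symmetric functions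 that sends the elementary symmetric function $e_k$ to the complete homogeneous symmetric function $h_k$ for all $k\ge 1$. A $P$-tableau of shape $\lambda$ is a filling $U=(U_{i,j})_{1\le i\le r,\,1\le j\le\lambda_i}$ of the Young diagram of $\lambda$ with the elements of $P$, each used exactly once. It is $P$-descent-free if there is no $(i,j)$ with $U_{i,j}>_P U_{i,j+1}$. It is $P$-excedance-free if there is no $(i,j)$ with $U_{i,j}>_P\overline U_{i,j}$, where $\overline U_{i,j}$ is the entry of row $i$ of $U$ whose label is $j$th smallest among the labels in that row. Then $\eta^\lambda(\mathrm{inc}(P))$ is equal to each of the following numbers: (1) the number of $P$-descent-free $P$-tableaux of shape $\lambda$; (2) the number of $P$-excedance-free $P$-tableaux of shape $\lambda$; (3) the number of sequences $(O_1,\dots,O_r)$ in which, for some ordered partition $(I_1,\dots,I_r)$ of the set $P$ into blocks with $|I_i|=\lambda_i$ for all $i$, each $O_i$ is an acyclic orientation of the subgraph of $\mathrm{inc}(P)$ induced by $I_i$. -/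

import Mathlib

noncomputable section

open scoped Classical

namespace ChromTrace

/-! ### Partitions, Young subgroups, induced characters -/

/-- The partition `lam` of `n` written as the weakly decreasing sequence
`(lam_1, …, lam_r)` of its (positive) parts. -/
def rows {n : ℕ} (lam : n.Partition) : Composition n where
  blocks := lam.parts.sort (· ≥ ·)
  blocks_pos := fun hi => lam.parts_pos ((Multiset.mem_sort (r := (· ≥ ·))).1 hi)
  blocks_sum := by
    rw [← Multiset.sum_coe, Multiset.sort_eq]
    exact lam.parts_sum

/-- The Young subgroup of the symmetric group of `Fin n` indexed by `lam`: the permutations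
that map each of the consecutive blocks of sizes `lam_1, …, lam_r` to itself. -/
def youngSubgroup {n : ℕ} (lam : n.Partition) : Subgroup (Equiv.Perm (Fin n)) where
  carrier := {w | ∀ k, (rows lam).index (w k) = (rows lam).index k}
  mul_mem' := fun {a b} ha hb k => by
    rw [Equiv.Perm.mul_apply, ha, hb]
  one_mem' := fun _ => rfl
  inv_mem' := fun {a} ha k => by
    have h := ha (a⁻¹ k)
    rw [← Equiv.Perm.mul_apply, mul_inv_cancel, Equiv.Perm.one_apply] at h
    exact h.symm

/-- The class function on a finite group `G` induced from a class function `f` on a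
subgroup `H`. -/
def induced {G : Type*} [Group G] [Fintype G] (H : Subgroup G) (f : H → ℚ) (w : G) : ℚ :=
  (Nat.card H : ℚ)⁻¹ * ∑ x : G, if h : x⁻¹ * w * x ∈ H then f ⟨x⁻¹ * w * x, h⟩ else 0

/-- The induced sign character `ε^lam`. -/
def inducedSign {n : ℕ} (lam : n.Partition) : Equiv.Perm (Fin n) → ℚ :=
  induced (youngSubgroup lam) fun u => ((Equiv.Perm.sign (u : Equiv.Perm (Fin n)) : ℤ) : ℚ)

/-- The induced trivial character `η^lam`. -/
def inducedTrivial {n : ℕ} (lam : n.Partition) : Equiv.Perm (Fin n) → ℚ :=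
  induced (youngSubgroup lam) fun _ => 1

/-- The value at `g ∈ ℚ[S_n]` of the linear extension of a class function `θ` on `S_n`. -/
def evalTrace {n : ℕ} (θ : Equiv.Perm (Fin n) → ℚ)
    (g : MonoidAlgebra ℚ (Equiv.Perm (Fin n))) : ℚ :=
  ∑ w, g.coeff w * θ w

/-! ### Symmetric functions, as power series in the variables `x_0, x_1, x_2, …` -/

/-- The monomial symmetric function `m_lam`: the sum of all monomials whose nonzero exponents
are, in some order, the parts of `lam`. -/
def mono {n : ℕ} (lam : n.Partition) : MvPowerSeries ℕ ℚ :=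
  fun d => if d.support.val.map d = lam.parts then 1 else 0

/-- The elementary symmetric function `e_k`. -/
def elem (k : ℕ) : MvPowerSeries ℕ ℚ :=
  fun d => if (∀ i, d i ≤ 1) ∧ d.degree = k then 1 else 0

/-- The complete homogeneous symmetric function `h_k`. -/
def homog (k : ℕ) : MvPowerSeries ℕ ℚ :=
  fun d => if d.degree = k then 1 else 0

/-- `F' = ω(F)`, where `ω` is the algebra homomorphism on symmetric functions with
`ω(e_k) = h_k` for all `k ≥ 1`: the symmetric function `F` is a polynomial in the
(algebraically independent) `e_1, e_2, …`, and `F'` is the same polynomial in `h_1, h_2, …`. -/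
def IsOmega (F F' : MvPowerSeries ℕ ℚ) : Prop :=
  ∃ f : MvPolynomial ℕ ℚ,
    MvPolynomial.aeval (fun k => elem (k + 1)) f = F ∧
    MvPolynomial.aeval (fun k => homog (k + 1)) f = F'

/-- The symmetric generating function `Y(g) = ∑_{lam ⊢ n} ε^lam(g) m_lam`. -/
def genY {n : ℕ} (g : MonoidAlgebra ℚ (Equiv.Perm (Fin n))) : MvPowerSeries ℕ ℚ :=
  ∑ lam : n.Partition, evalTrace (inducedSign lam) g • mono lam

/-- The chromatic symmetric function `X_G = ∑_κ ∏_v x_{κ(v)}`, the sum being over all proper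
colorings `κ` of `G`: the coefficient of `x^d` is the number of `κ` with `∏_v x_{κ(v)} = x^d`. -/
def chromSymm {V : Type*} [Fintype V] (G : SimpleGraph V) : MvPowerSeries ℕ ℚ :=
  fun d => (Nat.card {κ : G.Coloring ℕ // ∑ v, Finsupp.single (κ v) 1 = d} : ℚ)

/-! ### Incomparability graphs and acyclic orientations -/

/-- The incomparability graph of a poset. -/
def inc (P : Type*) [PartialOrder P] : SimpleGraph P where
  Adj a b := IncompRel (· ≤ ·) a b
  symm := ⟨fun _ _ h => ⟨h.2, h.1⟩⟩
  loopless := ⟨fun _ h => h.1 le_rfl⟩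

/-- `O` is an orientation of `G`: it has exactly one of the directed edges `(a, b)`, `(b, a)` for
each edge `{a, b}` of `G`, and no other edges. -/
def IsOrientation {V : Type*} (G : SimpleGraph V) (O : Digraph V) : Prop :=
  (∀ a b, O.Adj a b → G.Adj a b) ∧ ∀ a b, G.Adj a b → Xor (O.Adj a b) (O.Adj b a)

/-- A directed graph is acyclic if it has no directed cycle, that is, no nonempty directed walk
from a vertex to itself. -/
def IsAcyclicDigraph {V : Type*} (O : Digraph V) : Prop :=
  ∀ v, ¬ Relation.TransGen O.Adj v v

/-- The acyclic orientations of `G`. -/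
def AcyclicOrientation {V : Type*} (G : SimpleGraph V) : Type _ :=
  {O : Digraph V // IsOrientation G O ∧ IsAcyclicDigraph O}

/-- The ordered set partitions `(I_1, …, I_r)` of `V` of type `lam`. -/
def OrderedSetPartition (V : Type*) [Fintype V] {n : ℕ} (lam : n.Partition) : Type _ :=
  {I : Fin (rows lam).length → Finset V //
    (∀ i, (I i).card = (rows lam).blocksFun i) ∧
    (∀ i j, i ≠ j → Disjoint (I i) (I j)) ∧
    ∀ v, ∃ i, v ∈ I i}

/-- The acyclic orientations `(O_1, …, O_r)` of the ordered induced subgraph partitions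
`(G_{I_1}, …, G_{I_r})` of `G` of type `lam`. -/
def OrientedSubgraphPartition {V : Type*} [Fintype V] (G : SimpleGraph V) {n : ℕ}
    (lam : n.Partition) : Type _ :=
  Σ I : OrderedSetPartition V lam,
    ∀ i, AcyclicOrientation (G.induce (I.1 i : Set V))

/-! ### `P`-tableaux -/

/-- The boxes `(i, j)` of the Young diagram of shape `lam`: row `i` has `lam_i` boxes. -/
abbrev Box {n : ℕ} (lam : n.Partition) : Type :=
  Σ i : Fin (rows lam).length, Fin ((rows lam).blocksFun i)

/-- A `P`-tableau of shape `lam`: a filling of the boxes with the elements of `P`, each element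
of `P` being used exactly once. -/
abbrev Tableau (P : Type*) {n : ℕ} (lam : n.Partition) : Type _ := Box lam ≃ P

/-- `U` is `P`-descent-free: there is no `(i, j)` with `U_{i,j} >_P U_{i,j+1}`. -/
def DescentFree {P : Type*} [PartialOrder P] {n : ℕ} {lam : n.Partition}
    (U : Tableau P lam) : Prop :=
  ∀ (i : Fin (rows lam).length) (j j' : Fin ((rows lam).blocksFun i)),
    (j' : ℕ) = j + 1 → ¬ U ⟨i, j⟩ > U ⟨i, j'⟩

/-- The set of labels of the entries of row `i` of `U`. -/
def rowLabels {P : Type*} {n : ℕ} (label : P ≃ Fin n) {lam : n.Partition}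
    (U : Tableau P lam) (i : Fin (rows lam).length) : Finset (Fin n) :=
  Finset.univ.image fun j : Fin ((rows lam).blocksFun i) => label (U ⟨i, j⟩)

theorem card_rowLabels {P : Type*} {n : ℕ} (label : P ≃ Fin n) {lam : n.Partition}
    (U : Tableau P lam) (i : Fin (rows lam).length) :
    (rowLabels label U i).card = (rows lam).blocksFun i := by
  unfold rowLabels
  rw [Finset.card_image_of_injective]
  · simp
  · intro a b h
    simpa using h

/-- The entry of row `i` of `U` whose label is `j`th smallest among the labels in row `i`. -/
def sortedEntry {P : Type*} {n : ℕ} (label : P ≃ Fin n) {lam : n.Partition}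
    (U : Tableau P lam) (i : Fin (rows lam).length) (j : Fin ((rows lam).blocksFun i)) : P :=
  label.symm ((rowLabels label U i).orderEmbOfFin (card_rowLabels label U i) j)

/-- `U` is `P`-excedance-free: there is no `(i, j)` for which `U_{i,j}` is greater in `P` than
the entry of row `i` whose label is `j`th smallest. -/
def ExcedanceFree {P : Type*} [PartialOrder P] {n : ℕ} (label : P ≃ Fin n) {lam : n.Partition}
    (U : Tableau P lam) : Prop :=
  ∀ (i : Fin (rows lam).length) (j : Fin ((rows lam).blocksFun i)),
    ¬ U ⟨i, j⟩ > sortedEntry label U i j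

end ChromTrace

end

/-! Set functions on subsets of a finite set multiply by convolution, summing `u A * f (B \ A)` over
`A ⊆ B`. Call `f` the signed inverse of `u` when it inverts `A ↦ (-1)^|A| u A`. This is the relation
between the `e_k` and the `h_k`, so the sums `ordSum f` over ordered set partitions are linear
combinations of the sums `ordSum u`, with coefficients depending neither on `u` and `f` nor on the
ground set (`exists_ordSum_eq_linearCombination`).

The coefficients of `X_G` are the `ordSum` of the indicator of independent sets. The value of
`η^lam` at `w` is the `ordSum` of the indicator of `w`-invariant sets, since `η^lam` is a
permutation character on colorings (`inducedTrivial_eq`). The signed inverse of the latter indicator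
multiplies ordered sums by `sign w` (`ordSum_invariantSign`). Hence `Y(g) = X_G` is a linear
relation between ordered sums, and applying the universal combination to both sides yields `η^lam(g)
= ordSum f lam` for any signed inverse `f` of the independence indicator
(`evalTrace_inducedTrivial_eq_ordSum`).

Two such inverses are exhibited: the number of acyclic orientations, by summing over sets of
sources, and, for `inc P`, the number of descent-free words, by a sign-reversing involution.
Excedance-free rows are equinumerous with descent-free ones by an induction removing one element at
a time (`nonempty_wordsAvoiding_equiv_permsAvoiding`). Existence of `g` is inclusion–exclusion over
edges. The statement on `ω` holds because `ω` sends `sign w` times the power sum product of the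
cycle type of `w` to that product, and is well defined because the `e_k` are algebraically
independent. -/

noncomputable section
open scoped Classical
open Finset
namespace ChromTrace

/-! ### Sums over ordered set partitions -/

variable {V : Type*}

/-- The sum of `∏ i, u (I i)` over the ordered partitions `I` of `B` into blocks whose sizes are
given by a list. -/
def ordSum (u : Finset V → ℚ) : List ℕ → Finset V → ℚ
  | [], B => if B = ∅ then 1 else 0
  | k :: L, B => ∑ A ∈ B.powersetCard k, u A * ordSum u L (B \ A)

/-- `f` is inverse to `A ↦ (-1)^|A| u(A)` for the convolution product of set functions. -/
structure SignedInverse (u f : Finset V → ℚ) : Prop where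
  left_empty : u ∅ = 1
  right_empty : f ∅ = 1
  sum_eq_zero : ∀ B : Finset V, B.Nonempty →
    ∑ A ∈ B.powerset, (-1) ^ A.card * u A * f (B \ A) = 0

/-- Isolating the term `A = ∅` and grouping the others by size gives the analogue of `h_{k+1} = ∑_j
(-1)^j e_{j+1} h_{k-j}`. -/
theorem SignedInverse.eq_sum {u f : Finset V → ℚ} (h : SignedInverse u f) {B : Finset V} {k : ℕ}
    (hB : B.card = k + 1) :
    f B = ∑ j ∈ range (k + 1), (-1) ^ j * ∑ A ∈ B.powersetCard (j + 1), u A * f (B \ A) := by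
  have h0 := h.sum_eq_zero B (card_pos.1 (by omega))
  rw [sum_powerset, hB, sum_range_succ'] at h0
  simp only [powersetCard_zero, sum_singleton, card_empty, pow_zero, h.left_empty, sdiff_empty,
    one_mul] at h0
  rw [eq_neg_of_add_eq_zero_right h0, ← sum_neg_distrib]
  refine sum_congr rfl fun j _ => ?_
  rw [mul_sum, ← sum_neg_distrib]
  refine sum_congr rfl fun A hA => ?_
  rw [(mem_powersetCard.1 hA).2]
  ring

theorem ordSum_zero_cons {u : Finset V → ℚ} (hu : u ∅ = 1) (L : List ℕ) (B : Finset V) :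
    ordSum u (0 :: L) B = ordSum u L B := by
  simp [ordSum, hu]

/-- The recursion `eq_sum` is applied to the first block `A`, and the pair `A' ⊆ A` is recoded as
two consecutive blocks `A'`, `A \ A'` of sizes `j + 1` and `k - j`. -/
theorem SignedInverse.ordSum_succ_cons {u f : Finset V → ℚ} (h : SignedInverse u f) (k : ℕ)
    (L : List ℕ) (B : Finset V) :
    ordSum f ((k + 1) :: L) B = ∑ j ∈ range (k + 1), (-1) ^ j *
      ∑ A ∈ B.powersetCard (j + 1), u A * ordSum f ((k - j) :: L) (B \ A) := by
  have e : ordSum f ((k + 1) :: L) B = ∑ A ∈ B.powersetCard (k + 1), ∑ j ∈ range (k + 1),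
      (-1) ^ j * ∑ A' ∈ A.powersetCard (j + 1), u A' * f (A \ A') * ordSum f L (B \ A) := by
    rw [ordSum]
    refine sum_congr rfl fun A hA => ?_
    rw [h.eq_sum (mem_powersetCard.1 hA).2, sum_mul]
    refine sum_congr rfl fun j _ => ?_
    rw [mul_assoc, sum_mul]
  rw [e, sum_comm]
  refine sum_congr rfl fun j hj => ?_
  rw [← mul_sum]
  congr 1
  simp only [ordSum, mul_sum]
  rw [sum_sigma', sum_sigma']
  have hj' : j ≤ k := by simpa [Nat.lt_succ_iff] using hj
  refine sum_bij' (fun p _ => ⟨p.2, p.1 \ p.2⟩) (fun p _ => ⟨p.1 ∪ p.2, p.1⟩) ?_ ?_ ?_ ?_ ?_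
  · rintro ⟨A, A'⟩ hp
    simp only [mem_sigma, mem_powersetCard] at hp ⊢
    obtain ⟨⟨h1, h2⟩, h3, h4⟩ := hp
    refine ⟨⟨h3.trans h1, h4⟩, sdiff_subset_sdiff h1 le_rfl, ?_⟩
    rw [card_sdiff_of_subset h3]
    omega
  · rintro ⟨A, A'⟩ hp
    simp only [mem_sigma, mem_powersetCard] at hp ⊢
    obtain ⟨⟨h1, h2⟩, h3, h4⟩ := hp
    have hd : Disjoint A A' := disjoint_of_subset_right h3 disjoint_sdiff
    refine ⟨⟨union_subset h1 (h3.trans sdiff_subset), ?_⟩, subset_union_left, h2⟩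
    rw [card_union_of_disjoint hd]
    omega
  · rintro ⟨A, A'⟩ hp
    simp only [mem_sigma, mem_powersetCard] at hp
    simp [union_eq_right.2 hp.2.1]
  · rintro ⟨A, A'⟩ hp
    simp only [mem_sigma, mem_powersetCard] at hp
    have hd : Disjoint A A' := disjoint_of_subset_right hp.2.1 disjoint_sdiff
    simp [union_sdiff_cancel_left hd]
  · rintro ⟨A, A'⟩ hp
    simp only [mem_sigma, mem_powersetCard] at hp
    rw [sdiff_sdiff_left, mul_assoc, sup_eq_union, union_sdiff_of_subset hp.2.1]

/-- The sums over ordered partitions for `f` are universal linear combinations of those for `u`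
if `f` and `u` are related by `SignedInverse`. -/
theorem exists_ordSum_eq_linearCombination (V : Type*) (L : List ℕ) :
    ∃ c : List ℕ →₀ ℚ, ∀ u f : Finset V → ℚ, SignedInverse u f → ∀ B,
      ordSum f L B = Finsupp.linearCombination ℚ (fun α => ordSum u α B) c := by
  induction L with
  | nil =>
    refine ⟨Finsupp.single [] 1, fun u f _ B => ?_⟩
    simp [ordSum]
  | cons k L ih =>
    -- The recursion shortens the first part from `k + 1` to `k - j`; a first part `0` disappears
    -- because `f ∅ = 1`. The induction is thus on the first part, inside the one on the tail.
    induction k using Nat.strong_induction_on with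
    | _ k ihk =>
    rcases k with _ | k
    · obtain ⟨c, hc⟩ := ih
      exact ⟨c, fun u f h B => by rw [ordSum_zero_cons h.right_empty, hc u f h]⟩
    · choose! c hc using ihk
      -- Each `j` puts a part `j + 1` in front of the expansion of `(k - j) :: L`. That expansion is
      -- used on the sets `B \ A`, so its coefficients must not depend on the set.
      refine ⟨∑ j ∈ range (k + 1), ((-1 : ℚ) ^ j) • (c (k - j)).mapDomain (List.cons (j + 1)),
        fun u f h B => ?_⟩
      rw [h.ordSum_succ_cons, map_sum]
      refine sum_congr rfl fun j _ => ?_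
      rw [map_smul, smul_eq_mul, Finsupp.linearCombination_mapDomain]
      congr 1
      have e : ∀ α, ordSum u ((j + 1) :: α) B =
          ∑ A ∈ B.powersetCard (j + 1), u A * ordSum u α (B \ A) := fun _ => rfl
      simp only [Finsupp.linearCombination_apply, Finsupp.sum, Function.comp_apply, e,
        smul_eq_mul, mul_sum]
      rw [sum_comm]
      refine sum_congr rfl fun A _ => ?_
      rw [hc (k - j) (by omega) u f h, Finsupp.linearCombination_apply, Finsupp.sum, mul_sum]
      refine sum_congr rfl fun α _ => ?_
      rw [smul_eq_mul]
      ring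

/-- `I` is an ordered partition of `B` into blocks of the sizes given by `L`. -/
def IsOrdPartition (L : List ℕ) (B : Finset V) (I : Fin L.length → Finset V) : Prop :=
  (∀ i, (I i).card = L.get i) ∧ (∀ i j, i ≠ j → Disjoint (I i) (I j)) ∧ ∀ v, v ∈ B ↔ ∃ i, v ∈ I i

theorem isOrdPartition_cons {k : ℕ} {L : List ℕ} {B A : Finset V}
    {I : Fin L.length → Finset V} :
    IsOrdPartition (k :: L) B (Fin.cons A I : Fin (L.length + 1) → Finset V) ↔
      A ∈ B.powersetCard k ∧ IsOrdPartition L (B \ A) I := by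
  simp only [IsOrdPartition, List.length_cons, Fin.forall_fin_succ, Fin.exists_fin_succ,
    Fin.cons_zero, Fin.cons_succ, List.get_eq_getElem, Fin.val_zero, List.getElem_cons_zero,
    Fin.val_succ, List.getElem_cons_succ, mem_powersetCard, mem_sdiff, ne_eq, not_true_eq_false,
    Fin.succ_ne_zero, not_false_eq_true, forall_true_left, Fin.succ_inj, IsEmpty.forall_iff,
    true_and]
  constructor
  · rintro ⟨⟨h1, h2⟩, ⟨h3, h4⟩, h5⟩
    refine ⟨⟨fun v hv => (h5 v).2 (Or.inl hv), h1⟩, h2, fun i => (h4 i).2, fun v => ?_⟩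
    rw [h5 v]
    constructor
    · rintro ⟨h | h, h'⟩
      · exact absurd h h'
      · exact h
    · rintro ⟨i, hi⟩
      exact ⟨Or.inr ⟨i, hi⟩, fun hA => (disjoint_left.1 (h4 i).1 hi) hA⟩
  · rintro ⟨⟨h1, h2⟩, h3, h4, h5⟩
    have hd : ∀ i, Disjoint A (I i) := fun i => disjoint_right.2 fun v hv =>
      ((h5 v).2 ⟨i, hv⟩).2
    refine ⟨⟨h2, h3⟩, ⟨fun i _ => hd i, fun i => ⟨(hd i).symm, h4 i⟩⟩, fun v => ?_⟩
    rw [← h5 v]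
    by_cases hv : v ∈ A
    · simp [hv, h1 hv]
    · simp [hv]

/-- The recursive form suits inductions on the list of sizes; this closed form is the one to compare
with color classes, rows and orientations. -/
theorem ordSum_eq_sum [Fintype V] (u : Finset V → ℚ) (L : List ℕ) (B : Finset V) :
    ordSum u L B = ∑ I : Fin L.length → Finset V,
      if IsOrdPartition L B I then ∏ i, u (I i) else 0 := by
  induction L generalizing B with
  | nil =>
    rw [Fintype.sum_eq_single (fun i => i.elim0)]
    · have : IsOrdPartition [] B (fun i => i.elim0) ↔ B = ∅ := by
        simp only [IsOrdPartition]
        constructor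
        · intro h
          exact eq_empty_of_forall_notMem fun v hv => by
            obtain ⟨i, -⟩ := (h.2.2 v).1 hv
            exact i.elim0
        · rintro rfl
          exact ⟨fun i => i.elim0, fun i => i.elim0, fun v => by simp⟩
      rw [if_congr this rfl rfl]
      simp [ordSum]
    · intro I hI
      exact absurd (funext fun i => i.elim0) hI
  | cons k L ih =>
    refine Eq.trans ?_ ((Fin.consEquiv (fun _ : Fin (L.length + 1) => Finset V)).sum_comp
      (fun I => if IsOrdPartition (k :: L) B I then ∏ i, u (I i) else 0))
    rw [Fintype.sum_prod_type]
    have e : ∀ A (I : Fin L.length → Finset V),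
        (if IsOrdPartition (k :: L) B (Fin.cons A I : Fin (L.length + 1) → Finset V) then
          ∏ i : Fin (L.length + 1), u ((Fin.cons A I : Fin (L.length + 1) → Finset V) i) else 0) =
        if A ∈ B.powersetCard k ∧ IsOrdPartition L (B \ A) I then u A * ∏ i, u (I i) else 0 := by
      intro A I
      rw [Fin.prod_univ_succ, if_congr isOrdPartition_cons rfl rfl]
      simp only [Fin.cons_zero, Fin.cons_succ]
    refine Eq.trans ?_ (sum_congr rfl fun A _ => sum_congr rfl fun I _ => (e A I).symm)
    rw [ordSum, ← sum_subset (subset_univ (B.powersetCard k))]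
    · refine sum_congr rfl fun A hA => ?_
      rw [ih, mul_sum]
      refine sum_congr rfl fun I _ => ?_
      simp only [hA, true_and, mul_ite, mul_zero]
    · intro A _ hA
      simp [hA]

end ChromTrace
end

noncomputable section
open scoped Classical
open Finset
namespace ChromTrace

/-! ### Generating functions of colorings -/

variable {V : Type*} [Fintype V]

/-- The exponent vector of the monomial `∏ v, x_{κ v}`. -/
def content (κ : V → ℕ) : ℕ →₀ ℕ := ∑ v, Finsupp.single (κ v) 1

theorem content_apply (κ : V → ℕ) (i : ℕ) : content κ i = #{v | κ v = i} := by
  simp [content, Finsupp.finsetSum_apply, Finsupp.single_apply]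

theorem degree_content (κ : V → ℕ) : (content κ).degree = Fintype.card V := by
  simp [content, map_sum, Finsupp.degree_single]

theorem finite_content_eq (d : ℕ →₀ ℕ) : {κ : V → ℕ | content κ = d}.Finite := by
  refine (Set.Finite.pi' fun _ : V => d.support.finite_toSet).subset ?_
  rintro κ rfl v
  simp only [SetLike.mem_coe, Finsupp.mem_support_iff, content_apply, ne_eq, card_eq_zero]
  exact ne_empty_of_mem (a := v) (by simp)

/-- The finitely many colorings with a given exponent vector. -/
def colorings (V : Type*) [Fintype V] (d : ℕ →₀ ℕ) : Finset (V → ℕ) :=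
  (finite_content_eq d).toFinset

theorem mem_colorings {d : ℕ →₀ ℕ} {κ : V → ℕ} : κ ∈ colorings V d ↔ content κ = d := by
  simp [colorings]

/-- The sum of the monomials of all colorings with the property `φ`. -/
def colorSeries (φ : (V → ℕ) → Prop) : MvPowerSeries ℕ ℚ :=
  fun d => ∑ κ ∈ colorings V d, if φ κ then 1 else 0

theorem colorSeries_eq_card (φ : (V → ℕ) → Prop) (d : ℕ →₀ ℕ) :
    colorSeries φ d = (#{κ ∈ colorings V d | φ κ} : ℚ) := by
  rw [colorSeries, sum_boole]

theorem colorSeries_apply (φ : (V → ℕ) → Prop) (d : ℕ →₀ ℕ) :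
    colorSeries φ d = Nat.card {κ : V → ℕ // content κ = d ∧ φ κ} := by
  rw [colorSeries_eq_card, Nat.subtype_card]
  simp [mem_colorings]

theorem colorSeries_apply_of_degree_ne {φ : (V → ℕ) → Prop} {d : ℕ →₀ ℕ}
    (h : d.degree ≠ Fintype.card V) : colorSeries φ d = 0 := by
  refine sum_eq_zero fun κ hκ => absurd ?_ h
  rw [← mem_colorings.1 hκ, degree_content]

theorem chromSymm_eq_colorSeries (G : SimpleGraph V) :
    chromSymm G = colorSeries fun κ : V → ℕ => ∀ a b, G.Adj a b → κ a ≠ κ b := by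
  funext d
  rw [colorSeries_apply, chromSymm, Nat.cast_inj]
  refine Nat.card_congr ⟨fun κ => ⟨κ.1, κ.2, fun a b h => κ.1.valid h⟩,
    fun κ => ⟨⟨κ.1, fun {a b} h => κ.2.2 a b h⟩, κ.2.1⟩, fun κ => rfl, fun κ => rfl⟩

/-- The number of colorings with given numbers of vertices of the colors, all color classes of
which have a property. -/
theorem colorSeries_toFinsupp {Q : Finset V → Prop} (hQ : Q ∅) (L : List ℕ) :
    colorSeries (fun κ : V → ℕ => ∀ i, Q {v | κ v = i}) L.toFinsupp =
      ordSum (fun A => if Q A then 1 else 0) L univ := by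
  rw [colorSeries_apply, ordSum_eq_sum]
  simp only [prod_boole, mem_univ, forall_true_left, ← ite_and]
  rw [sum_boole, Nat.cast_inj, ← Nat.subtype_card (p := fun I : Fin L.length → Finset V =>
    IsOrdPartition L univ I ∧ ∀ i, Q (I i)) _ (by simp)]
  -- The exponent vector prescribes `L[i]` vertices of color `i` and none of any color beyond the
  -- list, so the classes of the listed colors exhaust `V`.
  have key : ∀ κ : V → ℕ, content κ = L.toFinsupp ↔
      IsOrdPartition L univ (fun i : Fin L.length => ({v | κ v = (i : ℕ)} : Finset V)) := by
    intro κ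
    constructor
    · intro h
      refine ⟨fun i => ?_, fun i j hij => ?_, fun v => ?_⟩
      · rw [← content_apply, h, List.toFinsupp_apply_fin]
        rfl
      · rw [disjoint_left]
        simp only [mem_filter, mem_univ, true_and]
        intro v h1 h2
        exact hij (Fin.ext (h1.symm.trans h2))
      · simp only [mem_univ, mem_filter, true_and, true_iff]
        by_contra! hv
        have hlt : L.length ≤ κ v := by
          by_contra! hlt
          exact hv ⟨_, hlt⟩ rfl
        have h1 : content κ (κ v) = 0 := by rw [h, List.toFinsupp_apply_le _ _ hlt]
        rw [content_apply, card_eq_zero] at h1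
        exact ne_empty_of_mem (a := v) (by simp) h1
    · rintro ⟨h1, -, h3⟩
      ext i
      rw [content_apply]
      by_cases hi : i < L.length
      · rw [List.toFinsupp_apply_lt _ _ hi]
        exact h1 ⟨i, hi⟩
      · rw [List.toFinsupp_apply_le _ _ (not_lt.1 hi), card_eq_zero]
        refine filter_eq_empty_iff.2 fun v _ hv => hi ?_
        obtain ⟨j, hj⟩ := (h3 v).1 (mem_univ v)
        simp only [mem_filter, mem_univ, true_and] at hj
        rw [← hv, hj]
        exact j.2
  refine Nat.card_eq_of_bijective (fun κ => ⟨fun i : Fin L.length => {v | κ.1 v = (i : ℕ)},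
    (key κ.1).1 κ.2.1, fun i => κ.2.2 i⟩) ⟨?_, ?_⟩
  · rintro ⟨κ, h1, h2⟩ ⟨κ', h1', h2'⟩ h
    refine Subtype.ext (funext fun v => ?_)
    obtain ⟨i, hi⟩ := (((key κ).1 h1).2.2 v).1 (mem_univ v)
    have hi' : v ∈ ({v | κ' v = (i : ℕ)} : Finset V) := by
      rw [← congrFun (Subtype.mk.inj h) i]
      exact hi
    simp only [mem_filter, mem_univ, true_and] at hi hi'
    exact hi.trans hi'.symm
  · rintro ⟨I, hI, hQI⟩
    choose c hc using fun v => (hI.2.2 v).1 (mem_univ v)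
    have hcI : ∀ i : Fin L.length, ({v | (c v : ℕ) = (i : ℕ)} : Finset V) = I i := by
      intro i
      ext v
      simp only [mem_filter, mem_univ, true_and]
      constructor
      · intro h
        rw [← Fin.ext h]
        exact hc v
      · intro h
        by_contra hne
        exact disjoint_left.1 (hI.2.1 (c v) i (fun h' => hne (congrArg _ h'))) (hc v) h
    refine ⟨⟨fun v => c v, (key _).2 ?_, fun i => ?_⟩, Subtype.ext (funext hcI)⟩
    · simp only [hcI]
      exact hI
    · by_cases hi : i < L.length
      · exact (hcI ⟨i, hi⟩).symm ▸ hQI ⟨i, hi⟩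
      -- Colors beyond the list have empty classes, whence the hypothesis on `∅`.
      · convert hQ
        refine filter_eq_empty_iff.2 fun v _ hv => hi ?_
        rw [← hv]
        exact (c v).2

/-! ### Induced characters and invariant colorings -/

/-- Bijections are chosen fiber by fiber. Besides matching parts with exponents, this shows that
permutations act transitively on the colorings with a given content. -/
theorem exists_equiv_comp_eq {α β γ : Type*} [Fintype α] [Fintype β] [DecidableEq γ] (f : α → γ)
    (g : β → γ)
    (h : ∀ c, #{a | f a = c} = #{b | g b = c}) : ∃ e : α ≃ β, ∀ a, g (e a) = f a := by
  have h' : ∀ c, Fintype.card {a // f a = c} = Fintype.card {b // g b = c} := by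
    intro c
    rw [Fintype.card_subtype, Fintype.card_subtype, h]
  refine ⟨(Equiv.sigmaFiberEquiv f).symm.trans ((Equiv.sigmaCongrRight fun c =>
    Fintype.equivOfCardEq (h' c)).trans (Equiv.sigmaFiberEquiv g)), fun a => ?_⟩
  exact (Fintype.equivOfCardEq (h' (f a)) ⟨a, rfl⟩).2

variable {n : ℕ}

/-- A coloring with exponent vector of type `lam` whose stabilizer is the Young subgroup. -/
theorem exists_coloring_youngSubgroup {lam : n.Partition} {d : ℕ →₀ ℕ}
    (hd : d.support.val.map d = lam.parts) :
    ∃ c : Fin n → ℕ, content c = d ∧ ∀ x : Equiv.Perm (Fin n),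
      x ∈ youngSubgroup lam ↔ ∀ k, c (x k) = c k := by
  obtain ⟨e, he⟩ := exists_equiv_comp_eq (rows lam).blocksFun (fun i : d.support => d i) (by
    intro c
    have h1 : (univ.val.map (rows lam).blocksFun) = lam.parts := by
      rw [Fin.univ_val_map, Composition.ofFn_blocksFun]
      exact Multiset.sort_eq lam.parts (· ≥ ·)
    have h2 : (univ.val.map fun i : d.support => d i) = lam.parts := by
      rw [← hd, ← Finset.attach_eq_univ]
      exact Multiset.attach_map_val' d.support.val d
    have h3 := congrArg (Multiset.count c) (h1.trans h2.symm)
    rw [Multiset.count_map, Multiset.count_map] at h3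
    simp only [eq_comm (a := c)] at h3
    exact h3)
  refine ⟨fun k => e ((rows lam).index k), ?_, fun x => ?_⟩
  · ext i
    rw [content_apply]
    by_cases hi : i ∈ d.support
    · obtain ⟨j, hj⟩ := e.surjective ⟨i, hi⟩
      have : ∀ k, ((e ((rows lam).index k) : ℕ) = i ↔ k ∈ Set.range ((rows lam).embedding j)) := by
        intro k
        rw [Composition.mem_range_embedding_iff', ← e.injective.eq_iff, hj, Subtype.ext_iff, eq_comm]
      simp only [this]
      have h4 := he j
      rw [hj] at h4
      rw [h4]
      have h5 : ({k | k ∈ Set.range ((rows lam).embedding j)} : Finset (Fin n)) =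
          univ.map ((rows lam).embedding j).toEmbedding := by
        ext k
        simp
      rw [h5, card_map, card_univ, Fintype.card_fin]
    · rw [Finsupp.notMem_support_iff.1 hi, card_eq_zero]
      refine filter_eq_empty_iff.2 fun k _ hk => hi ?_
      rw [← hk]
      exact (e _).2
  · simp only [Subtype.val_inj, e.injective.eq_iff]
    rfl

/-- Orbit–stabilizer: `c` has stabilizer the Young subgroup, so `x ↦ c ∘ x⁻¹` maps onto the
colorings of content `d` with left cosets as fibers, and `x⁻¹ * w * x` lies in the Young subgroup
exactly when `c ∘ x⁻¹` is fixed by `w`. -/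
theorem inducedTrivial_eq {lam : n.Partition} {d : ℕ →₀ ℕ}
    (hd : d.support.val.map d = lam.parts) (w : Equiv.Perm (Fin n)) :
    inducedTrivial lam w = colorSeries (fun κ : Fin n → ℕ => κ ∘ w = κ) d := by
  obtain ⟨c, hc, hst⟩ := exists_coloring_youngSubgroup hd
  have hcard : #{x : Equiv.Perm (Fin n) | x⁻¹ * w * x ∈ youngSubgroup lam} =
      #{κ ∈ colorings (Fin n) d | κ ∘ w = κ} * Nat.card (youngSubgroup lam) := by
    rw [card_eq_sum_card_fiberwise (f := fun x : Equiv.Perm (Fin n) => c ∘ ⇑x⁻¹)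
      (t := {κ ∈ colorings (Fin n) d | κ ∘ w = κ}), sum_const_nat]
    · intro κ hκ
      rw [mem_filter, mem_colorings] at hκ
      -- One permutation `x₀` carries `c` to `κ`; the fiber over `κ` is `x₀` times the Young
      -- subgroup.
      obtain ⟨x₀, hx₀⟩ := exists_equiv_comp_eq c κ (fun i => by
        rw [← content_apply, ← content_apply, hc, hκ.1])
      have hx₁ : ∀ a, c (x₀.symm a) = κ a := fun a => by
        rw [← hx₀, Equiv.apply_symm_apply]
      rw [Nat.card_eq_fintype_card, ← card_univ]
      refine (card_bij (fun h _ => x₀ * h.1) ?_ ?_ ?_).symm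
      · intro h _
        have hk : c ∘ ⇑(x₀ * h.1)⁻¹ = κ := by
          funext a
          have := (hst _).1 (inv_mem h.2) (x₀.symm a)
          rw [hx₁] at this
          exact this
        simp only [mem_filter, mem_univ, true_and, hk, and_true]
        rw [hst]
        intro k
        have h1 : ∀ a, c ((x₀ * h.1)⁻¹ a) = κ a := fun a => congrFun hk a
        rw [Equiv.Perm.mul_apply, Equiv.Perm.mul_apply, h1]
        have h2 := congrFun hκ.2 ((x₀ * h.1) k)
        rw [Function.comp_apply] at h2
        rw [h2, ← h1]
        simp
      · intro h _ h' _ hh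
        exact Subtype.ext (mul_left_cancel hh)
      · intro x hx
        simp only [mem_filter, mem_univ, true_and] at hx
        refine ⟨⟨x₀⁻¹ * x, (hst _).2 fun k => ?_⟩, mem_univ _, by simp⟩
        have h1 : c ((x₀⁻¹ * x) k) = κ (x k) := hx₁ (x k)
        rw [h1, ← hx.2]
        simp
    · intro x hx
      simp only [mem_coe, mem_filter, mem_univ, true_and, mem_colorings] at hx ⊢
      refine ⟨?_, funext fun a => ?_⟩
      · rw [← hc]
        ext i
        rw [content_apply, content_apply]
        exact card_equiv x⁻¹ fun a => by simp
      · have := (hst _).1 hx (x⁻¹ a)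
        simpa using this
  have hpos : (Nat.card (youngSubgroup lam) : ℚ) ≠ 0 := Nat.cast_ne_zero.2 Nat.card_pos.ne'
  rw [inducedTrivial, induced, colorSeries_eq_card]
  refine (congrArg (fun t : ℚ => (Nat.card (youngSubgroup lam) : ℚ)⁻¹ * t) (?_ : _ =
    (#{x : Equiv.Perm (Fin n) | x⁻¹ * w * x ∈ youngSubgroup lam} : ℚ))).trans ?_
  · rw [← sum_boole]
    exact sum_congr rfl fun x _ => by split_ifs <;> rfl
  · simp only [hcard]
    rw [Nat.cast_mul, mul_comm, mul_assoc, mul_inv_cancel₀ hpos, mul_one]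
    congr!

/-- The sign is invariant under conjugation, so it leaves the sum defining the induced character. -/
theorem inducedSign_eq (lam : n.Partition) (w : Equiv.Perm (Fin n)) :
    inducedSign lam w = (Equiv.Perm.sign w : ℤ) * inducedTrivial lam w := by
  rw [inducedSign, inducedTrivial, induced, induced, mul_left_comm]
  congr 1
  rw [mul_sum]
  refine sum_congr rfl fun x _ => ?_
  split_ifs
  · rcases Int.units_eq_one_or (Equiv.Perm.sign x) with h | h <;> simp [h]
  · simp

/-! ### Expansions in monomial symmetric functions -/

theorem coeff_eq_apply (F : MvPowerSeries ℕ ℚ) (d : ℕ →₀ ℕ) : MvPowerSeries.coeff d F = F d :=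
  rfl

theorem coeff_mono (lam : n.Partition) (d : ℕ →₀ ℕ) : MvPowerSeries.coeff d (mono lam) =
    if d.support.val.map d = lam.parts then 1 else 0 :=
  rfl

theorem sum_smul_mono {a : n.Partition → ℚ} {F : MvPowerSeries ℕ ℚ}
    (h : ∀ (lam : n.Partition) (d : ℕ →₀ ℕ), d.support.val.map d = lam.parts →
      a lam = MvPowerSeries.coeff d F)
    (h0 : ∀ d : ℕ →₀ ℕ, d.degree ≠ n → MvPowerSeries.coeff d F = 0) : ∑ lam, a lam • mono lam = F := by
  ext d
  rw [map_sum]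
  simp only [MvPowerSeries.coeff_smul, coeff_mono, mul_ite, mul_one, mul_zero]
  by_cases hd : d.degree = n
  · let lam : n.Partition := ⟨d.support.val.map d, fun hi => by
      obtain ⟨j, hj, rfl⟩ := Multiset.mem_map.1 hi
      exact Nat.pos_of_ne_zero (Finsupp.mem_support_iff.1 hj), by rw [← hd]; rfl⟩
    rw [sum_eq_single lam]
    · rw [if_pos rfl, h lam d rfl]
    · intro mu _ hmu
      rw [if_neg fun h' => hmu (Nat.Partition.ext h'.symm)]
    · simp
  · rw [h0 d hd]
    refine sum_eq_zero fun mu _ => if_neg fun h' => hd ?_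
    rw [← mu.parts_sum, ← h']
    rfl

theorem sum_evalTrace_inducedTrivial (g : MonoidAlgebra ℚ (Equiv.Perm (Fin n))) :
    ∑ lam : n.Partition, evalTrace (inducedTrivial lam) g • mono lam =
      ∑ w, g.coeff w • colorSeries fun κ : Fin n → ℕ => κ ∘ w = κ := by
  refine sum_smul_mono (fun lam d hd => ?_) fun d hd => ?_
  · rw [map_sum, evalTrace]
    exact sum_congr rfl fun w _ => by rw [inducedTrivial_eq hd, MvPowerSeries.coeff_smul, coeff_eq_apply]
  · rw [map_sum]
    refine sum_eq_zero fun w _ => ?_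
    rw [MvPowerSeries.coeff_smul, coeff_eq_apply,
      colorSeries_apply_of_degree_ne (by simpa using hd), mul_zero]

theorem genY_eq (g : MonoidAlgebra ℚ (Equiv.Perm (Fin n))) :
    genY g = ∑ w, (g.coeff w * (Equiv.Perm.sign w : ℤ)) •
      colorSeries fun κ : Fin n → ℕ => κ ∘ w = κ := by
  refine sum_smul_mono (fun lam d hd => ?_) fun d hd => ?_
  · rw [map_sum, evalTrace]
    exact sum_congr rfl fun w _ => by
      rw [inducedSign_eq, inducedTrivial_eq hd, ← mul_assoc, MvPowerSeries.coeff_smul,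
        coeff_eq_apply]
  · rw [map_sum]
    refine sum_eq_zero fun w _ => ?_
    rw [MvPowerSeries.coeff_smul, coeff_eq_apply,
      colorSeries_apply_of_degree_ne (by simpa using hd), mul_zero]

end ChromTrace
end

noncomputable section
open scoped Classical
open Finset
namespace ChromTrace

/-! ### Orbits of a permutation -/

variable {V : Type*}

/-- The set of orbits of a permutation. -/
abbrev Orbit (w : Equiv.Perm V) : Type _ := Quotient (Equiv.Perm.SameCycle.setoid w)

/-- The orbit of an element. -/
abbrev orbitOf (w : Equiv.Perm V) (v : V) : Orbit w :=
  Quotient.mk (Equiv.Perm.SameCycle.setoid w) v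

/-- `A` is a union of orbits of `w`. -/
def IsInvariant (w : Equiv.Perm V) (A : Finset V) : Prop :=
  ∀ v v', w.SameCycle v v' → v ∈ A → v' ∈ A

theorem orbitOf_eq_iff {w : Equiv.Perm V} {v v' : V} :
    orbitOf w v = orbitOf w v' ↔ w.SameCycle v v' :=
  Quotient.eq (r := Equiv.Perm.SameCycle.setoid w)

theorem IsInvariant.mem_iff {w : Equiv.Perm V} {B : Finset V} (h : IsInvariant w B) {v : V} :
    v ∈ B ↔ orbitOf w v ∈ B.image (orbitOf w) := by
  constructor
  · exact fun hv => mem_image_of_mem _ hv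
  · intro hv
    obtain ⟨v', hv', e⟩ := mem_image.1 hv
    exact h v' v (orbitOf_eq_iff.1 e) hv'

variable [Fintype V]

/-- The elements of an orbit. -/
def orbitFinset {w : Equiv.Perm V} (q : Orbit w) : Finset V := {v | orbitOf w v = q}

theorem mem_orbitFinset {w : Equiv.Perm V} {q : Orbit w} {v : V} :
    v ∈ orbitFinset q ↔ orbitOf w v = q := by
  simp [orbitFinset]

theorem comp_eq_self_iff {w : Equiv.Perm V} {κ : V → ℕ} :
    κ ∘ w = κ ↔ ∀ v v', w.SameCycle v v' → κ v = κ v' := by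
  constructor
  · intro h v v' hv
    obtain ⟨i, rfl⟩ := hv.exists_nat_pow_eq
    induction i with
    | zero => rfl
    | succ i ih =>
      rw [pow_succ', Equiv.Perm.mul_apply]
      exact (ih ⟨i, by simp⟩).trans (congrFun h ((w ^ i) v)).symm
  · intro h
    funext v
    exact (h v (w v) ⟨1, by simp⟩).symm

theorem comp_eq_self_iff_isInvariant {w : Equiv.Perm V} {κ : V → ℕ} :
    κ ∘ w = κ ↔ ∀ i, IsInvariant w {v | κ v = i} := by
  rw [comp_eq_self_iff]
  constructor
  · intro h i v v' hv hi
    simp only [mem_filter, mem_univ, true_and] at hi ⊢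
    rw [← h v v' hv, hi]
  · intro h v v' hv
    have := h (κ v) v v' hv (by simp)
    simp only [mem_filter, mem_univ, true_and] at this
    exact this.symm

/-- The cycle type sees only nontrivial cycles, but a fixed point contributes `-(-1)^1 = 1`, so the
product may run over all orbits. -/
theorem sign_eq_prod_orbit [DecidableEq V] (w : Equiv.Perm V) :
    Equiv.Perm.sign w = ∏ q : Orbit w, -(-1) ^ (orbitFinset q).card := by
  have hsupp : ∀ x, w x ≠ x → (w.cycleOf x).support = orbitFinset (orbitOf w x) := by
    intro x hx
    ext y
    rw [Equiv.Perm.mem_support_cycleOf_iff' hx, mem_orbitFinset, eq_comm, orbitOf_eq_iff]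
  have hout : ∀ q : Orbit w, orbitOf w q.out = q := fun q => Quotient.out_eq q
  rw [Equiv.Perm.sign_of_cycleType', Equiv.Perm.cycleType_def, Multiset.map_map]
  change ∏ c ∈ w.cycleFactorsFinset, -(-1) ^ #c.support = _
  rw [← prod_subset (subset_univ ({q | w q.out ≠ q.out} : Finset (Orbit w)))]
  · symm
    refine prod_bij (fun q _ => w.cycleOf q.out) ?_ ?_ ?_ ?_
    · intro q hq
      simpa [Equiv.Perm.cycleOf_mem_cycleFactorsFinset_iff] using hq
    · intro q hq q' hq' h
      simp only [mem_filter, mem_univ, true_and] at hq hq'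
      have h1 : q.out ∈ (w.cycleOf q'.out).support := by
        rw [← h, hsupp _ hq, mem_orbitFinset]
      rw [hsupp _ hq', mem_orbitFinset, hout, hout] at h1
      exact h1
    · intro c hc
      obtain ⟨x, hx⟩ := (Equiv.Perm.mem_cycleFactorsFinset_iff.1 hc).1.nonempty_support
      have hcx := Equiv.Perm.cycle_is_cycleOf hx hc
      have hsame : w.SameCycle (orbitOf w x).out x := orbitOf_eq_iff.1 (hout _)
      have hwx : w x ≠ x := by
        rw [← Equiv.Perm.mem_support]
        exact Equiv.Perm.mem_cycleFactorsFinset_support_le hc hx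
      refine ⟨orbitOf w x, ?_, ?_⟩
      · simp only [mem_filter, mem_univ, true_and]
        intro h
        exact hwx ((hsame.apply_eq_self_iff).1 h)
      · rw [hsame.cycleOf_eq, hcx]
    · intro q hq
      simp only [mem_filter, mem_univ, true_and] at hq
      rw [hsupp _ hq, hout]
  · intro q _ hq
    simp only [mem_filter, mem_univ, true_and, not_not] at hq
    have : orbitFinset q = {q.out} := by
      ext v
      rw [mem_orbitFinset, mem_singleton]
      constructor
      · intro h
        rw [← hout q, orbitOf_eq_iff] at h
        obtain ⟨i, hi⟩ := h.symm
        rw [← hi]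
        exact Equiv.Perm.zpow_apply_eq_self_of_apply_eq_self hq i
      · rintro rfl
        exact hout q
    simp [this]

theorem IsInvariant.card_eq {w : Equiv.Perm V} {B : Finset V} (h : IsInvariant w B) :
    B.card = ∑ q ∈ B.image (orbitOf w), (orbitFinset q).card := by
  rw [card_eq_sum_card_image (orbitOf w)]
  refine sum_congr rfl fun q hq => ?_
  congr 1
  ext v
  simp only [mem_filter, mem_orbitFinset, and_iff_right_iff_imp]
  rintro rfl
  exact h.mem_iff.2 hq

/-- The sign of the restriction of `w` to an invariant set. -/
def invariantSign (w : Equiv.Perm V) (A : Finset V) : ℚ :=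
  if IsInvariant w A then ∏ q ∈ A.image (orbitOf w), -(-1) ^ (orbitFinset q).card else 0

/-- For invariant `B`, expanding the vanishing product of `(-1)^|q| + -(-1)^|q|` over the orbits `q`
in `B` gives the required sum, as sets of orbits are the invariant subsets. For other `B`, the sets
`A` and `B \ A` are never both invariant. -/
theorem signedInverse_isInvariant (w : Equiv.Perm V) :
    SignedInverse (fun A => if IsInvariant w A then (1 : ℚ) else 0) (invariantSign w) where
  left_empty := by simp [IsInvariant]
  right_empty := by simp [invariantSign, IsInvariant]
  sum_eq_zero B hB := by
    by_cases hinv : IsInvariant w B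
    · have h0 : ∏ q ∈ B.image (orbitOf w),
          ((-1 : ℚ) ^ (orbitFinset q).card + -(-1) ^ (orbitFinset q).card) = 0 := by
        obtain ⟨v, hv⟩ := hB
        exact prod_eq_zero (mem_image_of_mem _ hv) (by ring)
      rw [prod_add] at h0
      refine Eq.trans ?_ h0
      have hpre : ∀ Q ⊆ B.image (orbitOf w),
          ({v ∈ B | orbitOf w v ∈ Q} : Finset V).image (orbitOf w) = Q := by
        intro Q hQ
        ext q
        simp only [mem_image, mem_filter]
        constructor
        · rintro ⟨v, ⟨-, h⟩, rfl⟩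
          exact h
        · intro hq
          obtain ⟨v, hv, rfl⟩ := mem_image.1 (hQ hq)
          exact ⟨v, ⟨hv, hq⟩, rfl⟩
      have hinvQ : ∀ Q : Finset (Orbit w), IsInvariant w ({v ∈ B | orbitOf w v ∈ Q} : Finset V) := by
        intro Q v v' hv h
        rw [mem_filter] at h ⊢
        exact ⟨hinv v v' hv h.1, orbitOf_eq_iff.2 hv ▸ h.2⟩
      have hsd : ∀ Q : Finset (Orbit w), B \ ({v ∈ B | orbitOf w v ∈ Q} : Finset V) =
          ({v ∈ B | orbitOf w v ∈ B.image (orbitOf w) \ Q} : Finset V) := by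
        intro Q
        ext v
        simp only [mem_sdiff, mem_filter, not_and]
        constructor
        · exact fun h => ⟨h.1, mem_image_of_mem _ h.1, h.2 h.1⟩
        · exact fun h => ⟨h.1, fun _ => h.2.2⟩
      symm
      refine sum_of_injOn (fun Q => ({v ∈ B | orbitOf w v ∈ Q} : Finset V)) ?_ ?_ ?_ ?_
      · intro Q hQ Q' hQ' h
        rw [← hpre Q (mem_powerset.1 (mem_coe.1 hQ)), ← hpre Q' (mem_powerset.1 (mem_coe.1 hQ'))]
        exact congrArg _ h
      · intro Q _
        exact mem_coe.2 (mem_powerset.2 (filter_subset _ _))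
      · intro A hA hne
        rw [if_neg]
        · simp
        · intro hAi
          refine hne ⟨A.image (orbitOf w), ?_, ?_⟩
          · exact mem_coe.2 (mem_powerset.2 (image_subset_image (mem_powerset.1 hA)))
          · ext v
            rw [mem_filter, ← hAi.mem_iff]
            exact ⟨fun h => h.2, fun h => ⟨mem_powerset.1 hA h, h⟩⟩
      · intro Q hQ
        rw [mem_powerset] at hQ
        rw [hsd, invariantSign, if_pos (hinvQ Q), if_pos (hinvQ _), hpre _ sdiff_subset,
          (hinvQ Q).card_eq, hpre _ hQ, mul_one, prod_pow_eq_pow_sum]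
    · refine sum_eq_zero fun A hA => ?_
      rw [mem_powerset] at hA
      by_cases h1 : IsInvariant w A
      · have h2 : ¬ IsInvariant w (B \ A) := fun h2 => hinv fun v v' hv h => by
          by_cases hvA : v ∈ A
          · exact hA (h1 v v' hv hvA)
          · exact sdiff_subset (h2 v v' hv (mem_sdiff.2 ⟨h, hvA⟩))
        rw [invariantSign, if_neg h2, mul_zero]
      · simp [h1]

/-- The orbits inside the blocks of an invariant ordered partition are all the orbits of `w`, each
once, so the signs on the blocks multiply to `sign w`. -/
theorem ordSum_invariantSign [DecidableEq V] (w : Equiv.Perm V) (L : List ℕ) :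
    ordSum (invariantSign w) L univ =
      (Equiv.Perm.sign w : ℤ) * ordSum (fun A => if IsInvariant w A then (1 : ℚ) else 0) L univ := by
  rw [ordSum_eq_sum, ordSum_eq_sum, mul_sum]
  refine sum_congr rfl fun I _ => ?_
  split_ifs with hI
  · rw [prod_boole]
    split_ifs with hinv
    · simp only [mem_univ, forall_true_left] at hinv
      rw [sign_eq_prod_orbit, mul_one]
      simp only [invariantSign, hinv, if_true]
      rw [← prod_biUnion]
      · push_cast
        refine prod_congr ?_ fun _ _ => rfl
        refine eq_univ_iff_forall.2 fun q => ?_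
        obtain ⟨v, rfl⟩ := Quotient.exists_rep q
        obtain ⟨i, hi⟩ := (hI.2.2 v).1 (mem_univ v)
        exact mem_biUnion.2 ⟨i, mem_univ _, mem_image_of_mem _ hi⟩
      · intro i _ j _ hij
        rw [Function.onFun, disjoint_left]
        intro q hq hq'
        obtain ⟨v, hv, rfl⟩ := mem_image.1 hq
        exact disjoint_left.1 (hI.2.1 i j hij) hv ((hinv j).mem_iff.2 hq')
    · simp only [mem_univ, forall_true_left, not_forall] at hinv
      obtain ⟨i, hi⟩ := hinv
      rw [mul_zero]
      exact prod_eq_zero (mem_univ i) (by simp [invariantSign, hi])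
  · simp

end ChromTrace
end

noncomputable section
open scoped Classical
open Finset
namespace ChromTrace

/-! ### Newton's identities -/

/-- The power sum symmetric function `p_k`, for `k ≥ 1`. -/
def powerSum (k : ℕ) : MvPowerSeries ℕ ℚ :=
  fun d => if ∃ i, d = Finsupp.single i k then 1 else 0

theorem coeff_powerSum (k : ℕ) (d : ℕ →₀ ℕ) :
    MvPowerSeries.coeff d (powerSum k) = if ∃ i, d = Finsupp.single i k then 1 else 0 :=
  rfl

theorem coeff_elem (k : ℕ) (d : ℕ →₀ ℕ) :
    MvPowerSeries.coeff d (elem k) = if (∀ i, d i ≤ 1) ∧ d.degree = k then 1 else 0 :=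
  rfl

theorem coeff_homog (k : ℕ) (d : ℕ →₀ ℕ) :
    MvPowerSeries.coeff d (homog k) = if d.degree = k then 1 else 0 :=
  rfl

theorem coeff_mul_powerSum (F : MvPowerSeries ℕ ℚ) {k : ℕ} (hk : 0 < k) (d : ℕ →₀ ℕ) :
    MvPowerSeries.coeff d (F * powerSum k) = ∑ i ∈ d.support,
      if k ≤ d i then MvPowerSeries.coeff (d - Finsupp.single i k) F else 0 := by
  rw [MvPowerSeries.coeff_mul, ← sum_filter]
  symm
  refine sum_of_injOn (fun i => (d - Finsupp.single i k, Finsupp.single i k)) ?_ ?_ ?_ ?_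
  · intro i _ j _ h
    exact (Finsupp.single_left_inj hk.ne').1 (Prod.mk.inj h).2
  · intro i hi
    simp only [coe_filter, Set.mem_ofPred_eq] at hi
    rw [mem_coe, HasAntidiagonal.mem_antidiagonal]
    exact tsub_add_cancel_of_le (Finsupp.single_le_iff.2 hi.2)
  · rintro ⟨a, b⟩ hab hne
    rw [HasAntidiagonal.mem_antidiagonal] at hab
    rw [coeff_powerSum, if_neg, mul_zero]
    rintro ⟨i, hi⟩
    refine hne ⟨i, ?_, ?_⟩
    · have h1 : d i = a i + k := by
        rw [← hab, hi]
        simp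
      simp only [coe_filter, Set.mem_ofPred_eq, Finsupp.mem_support_iff]
      omega
    · simp only at hi hab
      simp [← hab, hi]
  · intro i _
    rw [coeff_powerSum, if_pos ⟨i, rfl⟩, mul_one]

theorem degree_tsub_single {d : ℕ →₀ ℕ} {i k : ℕ} (h : k ≤ d i) :
    (d - Finsupp.single i k).degree + k = d.degree := by
  conv_rhs => rw [← tsub_add_cancel_of_le (Finsupp.single_le_iff.2 h), map_add,
    Finsupp.degree_single]

/-- In degree `k`, the coefficient of `x^d` in the `j`th product counts the `i` with `j < d i`;
summing over `j` gives `∑ d i = k`. -/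
theorem sum_homog_mul_powerSum (k : ℕ) :
    ∑ j ∈ range k, homog (k - 1 - j) * powerSum (j + 1) = (k : ℚ) • homog k := by
  ext d
  rw [map_sum, MvPowerSeries.coeff_smul, coeff_homog]
  have e : ∀ j ∈ range k, MvPowerSeries.coeff d (homog (k - 1 - j) * powerSum (j + 1)) =
      ∑ i ∈ d.support, if d.degree = k ∧ j < d i then 1 else 0 := by
    intro j hj
    rw [coeff_mul_powerSum (k := j + 1) _ (by omega)]
    refine sum_congr rfl fun i _ => ?_
    rw [mem_range] at hj
    by_cases h : j + 1 ≤ d i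
    · have := degree_tsub_single h
      rw [if_pos h, coeff_homog]
      exact if_congr ⟨fun h3 => ⟨by omega, by omega⟩, fun h3 => by omega⟩ rfl rfl
    · rw [if_neg h, if_neg (by omega)]
  rw [sum_congr rfl e, sum_comm]
  by_cases hd : d.degree = k
  · simp only [hd, true_and, if_true, mul_one]
    rw [← hd, Finsupp.degree_apply, Nat.cast_sum]
    refine sum_congr rfl fun i hi => ?_
    have hle : d i ≤ ∑ i ∈ d.support, d i := single_le_sum (f := d) (fun _ _ => Nat.zero_le _) hi
    rw [sum_boole, Nat.cast_inj]
    have : ({x ∈ range (∑ i ∈ d.support, d i) | x < d i} : Finset ℕ) = range (d i) := by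
      ext x
      simp only [mem_filter, mem_range]
      omega
    rw [this, card_range]
  · simp [hd]

/-- Only `j = m - 1` and `j = m - 2` contribute, and they cancel unless `m = 1`. -/
theorem sum_range_neg_one_pow_tsub_le (m : ℕ) (hm : 0 < m) :
    ∑ j ∈ range m, (if m - (j + 1) ≤ 1 then (-1 : ℚ) ^ j else 0) = if m = 1 then 1 else 0 := by
  rcases m with _ | _ | m
  · omega
  · simp
  · rw [sum_range_succ, sum_range_succ, sum_eq_zero]
    · simp [pow_succ]
    · intro j hj
      rw [mem_range] at hj
      rw [if_neg (by omega)]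

/-- Dividing `x^d` by `x_i^(j+1)` must leave a squarefree monomial. The alternating sum over `j`
cancels if `d i ≥ 2`, so only squarefree `x^d` survive, with one contribution from each of their `k`
variables. -/
theorem sum_elem_mul_powerSum (k : ℕ) :
    ∑ j ∈ range k, ((-1 : ℚ) ^ j) • (elem (k - 1 - j) * powerSum (j + 1)) = (k : ℚ) • elem k := by
  ext d
  rw [map_sum, MvPowerSeries.coeff_smul, coeff_elem]
  have e : ∀ j ∈ range k, MvPowerSeries.coeff d
      (((-1 : ℚ) ^ j) • (elem (k - 1 - j) * powerSum (j + 1))) =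
      ∑ i ∈ d.support, if d.degree = k ∧ j < d i then
        if ∀ l, l ≠ i → d l ≤ 1 then if d i - (j + 1) ≤ 1 then (-1) ^ j else 0 else 0 else 0 := by
    intro j hj
    rw [MvPowerSeries.coeff_smul, coeff_mul_powerSum (k := j + 1) _ (by omega), mul_sum]
    refine sum_congr rfl fun i _ => ?_
    rw [mem_range] at hj
    by_cases h : j + 1 ≤ d i
    · have := degree_tsub_single h
      have h2 : (∀ l, (d - Finsupp.single i (j + 1)) l ≤ 1) ↔
          (∀ l, l ≠ i → d l ≤ 1) ∧ d i - (j + 1) ≤ 1 := by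
        simp only [Finsupp.tsub_apply, Finsupp.single_apply]
        constructor
        · intro h3
          refine ⟨fun l hl => ?_, ?_⟩
          · simpa [hl.symm] using h3 l
          · simpa using h3 i
        · rintro ⟨h3, h4⟩ l
          by_cases hl : l = i
          · subst hl
            simpa using h4
          · simpa [Ne.symm hl] using h3 l hl
      have h3 : (d - Finsupp.single i (j + 1)).degree = k - 1 - j ↔ d.degree = k :=
        ⟨fun h3 => by omega, fun h3 => by omega⟩
      have h4 : j < d i := h
      rw [if_pos h, coeff_elem]
      simp only [h2, h3]
      generalize (∀ l, l ≠ i → d l ≤ 1) = A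
      by_cases A <;> by_cases d i - (j + 1) ≤ 1 <;> by_cases d.degree = k <;>
        simp_all only [and_self, and_true, and_false, if_true, if_false, mul_one, mul_zero]
    · rw [if_neg h, if_neg (by omega), mul_zero]
  rw [sum_congr rfl e, sum_comm]
  by_cases hd : d.degree = k
  · simp only [hd, true_and, and_true]
    have e2 : ∀ i ∈ d.support, (∑ j ∈ range k, if j < d i then
        if ∀ l, l ≠ i → d l ≤ 1 then if d i - (j + 1) ≤ 1 then (-1 : ℚ) ^ j else 0 else 0 else 0) =
        if ∀ l, d l ≤ 1 then 1 else 0 := by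
      intro i hi
      have hle : d i ≤ k := by
        rw [← hd, Finsupp.degree_apply]
        exact single_le_sum (f := d) (fun _ _ => Nat.zero_le _) hi
      have hpos : 0 < d i := Nat.pos_of_ne_zero (Finsupp.mem_support_iff.1 hi)
      rw [← sum_filter]
      have : ({x ∈ range k | x < d i} : Finset ℕ) = range (d i) := by
        ext x
        simp only [mem_filter, mem_range]
        omega
      rw [this]
      by_cases h : ∀ l, l ≠ i → d l ≤ 1
      · simp only [if_pos h]
        rw [sum_range_neg_one_pow_tsub_le _ hpos]
        refine if_congr ⟨fun h1 l => ?_, fun h1 => ?_⟩ rfl rfl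
        · by_cases hl : l = i
          · rw [hl, h1]
          · exact h l hl
        · have := h1 i
          omega
      · rw [if_neg fun h1 => h fun l _ => h1 l]
        simp [h]
    rw [sum_congr rfl e2, sum_const, nsmul_eq_mul]
    by_cases h : ∀ l, d l ≤ 1
    · simp only [h, implies_true, if_true, mul_one, Nat.cast_inj]
      rw [← hd, Finsupp.degree_apply, card_eq_sum_ones]
      refine sum_congr rfl fun i hi => ?_
      have := Finsupp.mem_support_iff.1 hi
      have := h i
      omega
    · simp [h]
  · simp [hd]

/-! ### The graph of `ω` -/

/-- The graph of `ω`. -/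
def omegaGraph : Subalgebra ℚ (MvPowerSeries ℕ ℚ × MvPowerSeries ℕ ℚ) :=
  (MvPolynomial.aeval (R := ℚ) fun k : ℕ => (elem (k + 1), homog (k + 1))).range

/-- With `ω` recorded as a subalgebra of a product, values of `ω` are obtained from closure under
sums and products, without first knowing that `ω` is single-valued. -/
theorem mem_omegaGraph {F F' : MvPowerSeries ℕ ℚ} : (F, F') ∈ omegaGraph ↔ IsOmega F F' := by
  have h1 : ∀ f : MvPolynomial ℕ ℚ,
      (MvPolynomial.aeval (R := ℚ) fun k : ℕ => (elem (k + 1), homog (k + 1))) f =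
      (MvPolynomial.aeval (fun k => elem (k + 1)) f,
        MvPolynomial.aeval (fun k => homog (k + 1)) f) := by
    intro f
    refine Prod.ext ?_ ?_
    · exact DFunLike.congr_fun (MvPolynomial.comp_aeval
        (fun k : ℕ => (elem (k + 1), homog (k + 1)))
        (AlgHom.fst ℚ (MvPowerSeries ℕ ℚ) (MvPowerSeries ℕ ℚ))) f
    · exact DFunLike.congr_fun (MvPolynomial.comp_aeval
        (fun k : ℕ => (elem (k + 1), homog (k + 1)))
        (AlgHom.snd ℚ (MvPowerSeries ℕ ℚ) (MvPowerSeries ℕ ℚ))) f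
  rw [omegaGraph, AlgHom.mem_range]
  simp only [h1, Prod.mk.injEq]
  rfl

theorem elem_zero : elem 0 = 1 := by
  ext d
  rw [coeff_elem, MvPowerSeries.coeff_one]
  refine if_congr ⟨fun h => (Finsupp.degree_eq_zero_iff d).1 h.2, ?_⟩ rfl rfl
  rintro rfl
  simp

theorem homog_zero : homog 0 = 1 := by
  ext d
  rw [coeff_homog, MvPowerSeries.coeff_one]
  exact if_congr (Finsupp.degree_eq_zero_iff d) rfl rfl

theorem elem_homog_mem_omegaGraph (k : ℕ) : (elem k, homog k) ∈ omegaGraph := by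
  rcases k with _ | k
  · rw [elem_zero, homog_zero]
    exact one_mem omegaGraph
  · exact ⟨MvPolynomial.X k, by simp⟩

/-- The two Newton identities are the components of one identity in the product algebra, which
expresses the pair for `p_{k+1}` through earlier pairs and the pairs `(e_j, h_j)`. -/
theorem powerSum_mem_omegaGraph (k : ℕ) :
    (((-1 : ℚ) ^ k) • powerSum (k + 1), powerSum (k + 1)) ∈ omegaGraph := by
  induction k using Nat.strong_induction_on with
  | _ k ih =>
  have h1 := sum_elem_mul_powerSum (k + 1)
  have h2 := sum_homog_mul_powerSum (k + 1)
  rw [sum_range_succ] at h1 h2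
  simp only [Nat.add_sub_cancel, Nat.sub_self, elem_zero, homog_zero, one_mul] at h1 h2
  have h3 : (((-1 : ℚ) ^ k) • powerSum (k + 1), powerSum (k + 1)) =
      ((k + 1 : ℕ) : ℚ) • (elem (k + 1), homog (k + 1)) - ∑ j ∈ range k,
        (elem (k - j), homog (k - j)) * (((-1 : ℚ) ^ j) • powerSum (j + 1), powerSum (j + 1)) := by
    refine Prod.ext ?_ ?_
    · simp only [Prod.fst_sub, Prod.smul_fst, Prod.fst_sum, Prod.fst_mul, mul_smul_comm]
      rw [← h1]
      abel
    · simp only [Prod.snd_sub, Prod.smul_snd, Prod.snd_sum, Prod.snd_mul]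
      rw [← h2]
      abel
  rw [h3]
  refine sub_mem (Subalgebra.smul_mem _ (elem_homog_mem_omegaGraph _) _) (sum_mem fun j hj => ?_)
  exact mul_mem (elem_homog_mem_omegaGraph _) (ih j (mem_range.1 hj))

/-! ### Invariant colorings and power sums -/

variable {V : Type*} [Fintype V]

theorem orbitFinset_card_pos {w : Equiv.Perm V} (q : Orbit w) : 0 < (orbitFinset q).card := by
  obtain ⟨v, rfl⟩ := Quotient.exists_rep q
  exact card_pos.2 ⟨v, mem_orbitFinset.2 rfl⟩

theorem sum_prod_boole_eq_card {α ι : Type*} [Fintype ι] (s : Finset α) (p : α → ι → Prop) :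
    ∑ x ∈ s, ∏ i, (if p x i then (1 : ℚ) else 0) = Nat.card {x // x ∈ s ∧ ∀ i, p x i} := by
  simp only [prod_boole, mem_univ, forall_true_left]
  rw [sum_boole, Nat.cast_inj, ← Nat.subtype_card (p := fun x => x ∈ s ∧ ∀ i, p x i) _ (by simp)]

/-- An invariant coloring is a free choice of one color per orbit, and an orbit `q` of color `i`
contributes `x_i^|q|`. -/
theorem colorSeries_eq_prod_powerSum (w : Equiv.Perm V) :
    colorSeries (fun κ : V → ℕ => κ ∘ w = κ) = ∏ q : Orbit w, powerSum (orbitFinset q).card := by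
  have hout : ∀ q : Orbit w, orbitOf w q.out = q := fun q => Quotient.out_eq q
  have hsum : ∀ (κ : V → ℕ) (k : Orbit w → ℕ), (∀ v, κ v = k (orbitOf w v)) →
      content κ = ∑ q, Finsupp.single (k q) (orbitFinset q).card := by
    intro κ k h
    rw [content, ← sum_fiberwise univ (orbitOf w)]
    refine sum_congr rfl fun q _ => ?_
    have : ∀ v ∈ ({v | orbitOf w v = q} : Finset V), Finsupp.single (κ v) 1 =
        Finsupp.single (k q) 1 := by
      intro v hv
      rw [mem_filter] at hv
      rw [h, hv.2]
    rw [sum_congr rfl this, sum_const, orbitFinset]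
    simp
  ext d
  rw [MvPowerSeries.coeff_prod]
  simp only [coeff_powerSum]
  rw [sum_prod_boole_eq_card, coeff_eq_apply, colorSeries_apply, Nat.cast_inj]
  -- A term of the product selects the factor of each orbit; the color can be read off from it
  -- because orbits are nonempty.
  refine Nat.card_eq_of_bijective (fun κ => ⟨Finsupp.equivFunOnFinite.symm fun q : Orbit w =>
    Finsupp.single (κ.1 q.out) (orbitFinset q).card, ?_, fun q => ⟨_, rfl⟩⟩) ⟨?_, ?_⟩
  · have h := comp_eq_self_iff.1 κ.2.2
    rw [mem_finsuppAntidiag]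
    refine ⟨?_, subset_univ _⟩
    exact (hsum κ.1 (fun q => κ.1 q.out) fun v => h _ _ (orbitOf_eq_iff.1 (hout _).symm)).symm.trans
      κ.2.1
  · rintro ⟨κ, hκ, hw⟩ ⟨κ', hκ', hw'⟩ h
    rw [comp_eq_self_iff] at hw hw'
    refine Subtype.ext (funext fun v => ?_)
    have h1 := DFunLike.congr_fun (Subtype.mk.inj h) (orbitOf w v)
    have h2 := (Finsupp.single_left_inj (orbitFinset_card_pos _).ne').1 h1
    have h3 : w.SameCycle v (orbitOf w v).out := orbitOf_eq_iff.1 (hout _).symm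
    exact (hw _ _ h3).trans (h2.trans (hw' _ _ h3).symm)
  · rintro ⟨l, hl', hi⟩
    have hl := mem_finsuppAntidiag.1 hl'
    choose i hi' using fun q => hi q
    refine ⟨⟨fun v => i (orbitOf w v), ?_, comp_eq_self_iff.2 fun v v' h =>
      congrArg i (orbitOf_eq_iff.2 h)⟩, Subtype.ext ?_⟩
    · rw [hsum _ i fun _ => rfl, ← hl.1]
      exact sum_congr rfl fun q _ => (hi' q).symm
    · ext1 q
      change Finsupp.single (i (orbitOf w q.out)) _ = l q
      rw [hout, hi']

theorem invariantSeries_mem_omegaGraph [DecidableEq V] (w : Equiv.Perm V) :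
    (((Equiv.Perm.sign w : ℤ) : ℚ) • colorSeries (fun κ : V → ℕ => κ ∘ w = κ),
      colorSeries (fun κ : V → ℕ => κ ∘ w = κ)) ∈ omegaGraph := by
  have h : (((Equiv.Perm.sign w : ℤ) : ℚ) • colorSeries (fun κ : V → ℕ => κ ∘ w = κ),
      colorSeries (fun κ : V → ℕ => κ ∘ w = κ)) = ∏ q : Orbit w,
      (((-1 : ℚ) ^ ((orbitFinset q).card - 1)) • powerSum ((orbitFinset q).card - 1 + 1),
        powerSum ((orbitFinset q).card - 1 + 1)) := by
    have e : ∀ q : Orbit w, (orbitFinset q).card - 1 + 1 = (orbitFinset q).card := fun q =>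
      Nat.sub_add_cancel (orbitFinset_card_pos q)
    have e2 : ∀ q : Orbit w,
        (-1 : ℚ) ^ ((orbitFinset q).card - 1) = -(-1) ^ (orbitFinset q).card := fun q => by
      conv_rhs => rw [← e q, pow_succ]
      ring
    refine Prod.ext ?_ ?_
    · rw [Prod.fst_prod]
      simp only [e, e2]
      rw [prod_smul, ← colorSeries_eq_prod_powerSum, sign_eq_prod_orbit]
      push_cast
      rfl
    · rw [Prod.snd_prod]
      simp only [e]
      rw [colorSeries_eq_prod_powerSum]
  rw [h]
  exact prod_mem fun q _ => powerSum_mem_omegaGraph _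

theorem isOmega_genY {n : ℕ} (g : MonoidAlgebra ℚ (Equiv.Perm (Fin n))) :
    IsOmega (genY g) (∑ lam : n.Partition, evalTrace (inducedTrivial lam) g • mono lam) := by
  rw [← mem_omegaGraph, genY_eq, sum_evalTrace_inducedTrivial]
  have h : (∑ w, (g.coeff w * (Equiv.Perm.sign w : ℤ)) •
      colorSeries fun κ : Fin n → ℕ => κ ∘ w = κ,
      ∑ w, g.coeff w • colorSeries fun κ : Fin n → ℕ => κ ∘ w = κ) =
      ∑ w, g.coeff w • (((Equiv.Perm.sign w : ℤ) : ℚ) • colorSeries (fun κ : Fin n → ℕ => κ ∘ w = κ),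
        colorSeries (fun κ : Fin n → ℕ => κ ∘ w = κ)) := by
    refine Prod.ext ?_ ?_
    · simp only [Prod.fst_sum, Prod.smul_fst, mul_smul]
    · simp only [Prod.snd_sum, Prod.smul_snd]
  rw [h]
  exact sum_mem fun w _ => Subalgebra.smul_mem _ (invariantSeries_mem_omegaGraph w) _

end ChromTrace
end

noncomputable section
open scoped Classical
open Finset
namespace ChromTrace

/-! ### Algebraic independence of the elementary symmetric functions -/

theorem coeff_esymm {N : ℕ} (k : ℕ) (x : Fin N →₀ ℕ) :
    MvPolynomial.coeff x (MvPolynomial.esymm (Fin N) ℚ k) =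
      if (∀ i, x i ≤ 1) ∧ x.degree = k then 1 else 0 := by
  have happ : ∀ (t : Finset (Fin N)) (i : Fin N), (∑ j ∈ t, Finsupp.single j 1 : Fin N →₀ ℕ) i =
      if i ∈ t then 1 else 0 := by
    intro t i
    simp [Finsupp.finsetSum_apply, Finsupp.single_apply]
  have hiff : ∀ t ∈ powersetCard k (univ : Finset (Fin N)), (∑ j ∈ t, Finsupp.single j 1 = x ↔
      t = x.support ∧ ∀ i, x i ≤ 1) := by
    intro t _
    constructor
    · rintro rfl
      refine ⟨?_, fun i => ?_⟩
      · ext i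
        rw [Finsupp.mem_support_iff, happ]
        simp
      · rw [happ]
        split_ifs <;> simp
    · rintro ⟨rfl, h⟩
      ext i
      rw [happ]
      have := h i
      by_cases hi : i ∈ x.support
      · have := Finsupp.mem_support_iff.1 hi
        rw [if_pos hi]
        omega
      · rw [if_neg hi, Finsupp.notMem_support_iff.1 hi]
  rw [MvPolynomial.esymm_eq_sum_monomial, MvPolynomial.coeff_sum]
  simp only [MvPolynomial.coeff_monomial]
  rw [sum_congr rfl fun t ht => if_congr (hiff t ht) rfl rfl]
  by_cases h : ∀ i, x i ≤ 1
  · have hdeg : x.degree = x.support.card := by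
      rw [Finsupp.degree_apply, card_eq_sum_ones]
      refine sum_congr rfl fun i hi => ?_
      have := h i
      have := Finsupp.mem_support_iff.1 hi
      omega
    simp [h, hdeg, mem_powersetCard]
  · simp [h]

theorem killCompl_elem (N k : ℕ) :
    MvPowerSeries.killCompl (R := ℚ) (Fin.valEmbedding (n := N)) (elem k) =
      (MvPolynomial.esymm (Fin N) ℚ k : MvPowerSeries (Fin N) ℚ) := by
  ext x
  rw [MvPowerSeries.coeff_killCompl, MvPolynomial.coeff_coe, coeff_elem]
  refine Eq.trans ?_ (coeff_esymm k x).symm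
  refine if_congr (and_congr ⟨fun h i => ?_, fun h i => ?_⟩ ?_) rfl rfl
  · have := h (Fin.valEmbedding i)
    rwa [Finsupp.embDomain_apply_self] at this
  · by_cases hi : i ∈ Set.range (Fin.valEmbedding (n := N))
    · obtain ⟨j, rfl⟩ := hi
      rw [Finsupp.embDomain_apply_self]
      exact h j
    · rw [Finsupp.embDomain_of_notMem_range _ _ _ hi]
      exact Nat.zero_le _
  · rw [Finsupp.embDomain_eq_mapDomain, Finsupp.degree_mapDomain]

/-- A polynomial relation involves finitely many `e_1, …, e_N`. Setting all but `N` variables to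
zero turns these into the elementary symmetric polynomials in `N` variables, which are algebraically
independent. -/
theorem aeval_elem_injective :
    Function.Injective (MvPolynomial.aeval (R := ℚ) fun k : ℕ => elem (k + 1)) := by
  rw [injective_iff_map_eq_zero]
  intro f hf
  obtain ⟨N, hN⟩ : ∃ N, ∀ i ∈ f.vars, i < N :=
    ⟨f.vars.sup id + 1, fun i hi => Nat.lt_succ_of_le (le_sup (f := id) hi)⟩
  obtain ⟨f', rfl⟩ := MvPolynomial.exists_rename_eq_of_vars_subset_range f
    (Fin.val : Fin N → ℕ) Fin.val_injective fun i hi => ⟨⟨i, hN i hi⟩, rfl⟩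
  have h1 := congrArg (MvPowerSeries.killCompl (R := ℚ) (Fin.valEmbedding (n := N))) hf
  rw [MvPolynomial.aeval_rename, map_zero, ← AlgHom.comp_apply, MvPolynomial.comp_aeval] at h1
  simp only [Function.comp_apply, killCompl_elem] at h1
  have h2 : (MvPolynomial.coeToMvPowerSeries.algHom ℚ)
      (MvPolynomial.aeval (fun i : Fin N => MvPolynomial.esymm (Fin N) ℚ (i + 1)) f') = 0 := by
    rw [← AlgHom.comp_apply, MvPolynomial.comp_aeval]
    refine Eq.trans ?_ h1
    congr 1
  have h3 : MvPolynomial.aeval (fun i : Fin N => MvPolynomial.esymm (Fin N) ℚ (i + 1)) f' = 0 := by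
    refine MvPolynomial.coe_injective _ _ ?_
    rw [MvPolynomial.coe_zero]
    exact h2
  have h4 : MvPolynomial.esymmAlgHom (Fin N) ℚ N f' = 0 := by
    apply Subtype.ext
    rw [MvPolynomial.esymmAlgHom_apply, h3]
    rfl
  rw [(injective_iff_map_eq_zero _).1 (MvPolynomial.esymmAlgHom_fin_injective ℚ le_rfl) f' h4,
    map_zero]

theorem IsOmega.unique {F F₁ F₂ : MvPowerSeries ℕ ℚ} (h₁ : IsOmega F F₁) (h₂ : IsOmega F F₂) :
    F₁ = F₂ := by
  obtain ⟨f₁, e₁, rfl⟩ := h₁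
  obtain ⟨f₂, e₂, rfl⟩ := h₂
  rw [aeval_elem_injective (e₁.trans e₂.symm)]

end ChromTrace
end

noncomputable section
open scoped Classical
open Finset
namespace ChromTrace

/-! ### Acyclic orientations -/

variable {V : Type*}

/-- `R` is an acyclic orientation of the subgraph of `G` induced by `B`. -/
structure IsAcyclicOn (G : SimpleGraph V) (B : Finset V) (R : V → V → Prop) : Prop where
  mem : ∀ a b, R a b → a ∈ B ∧ b ∈ B ∧ G.Adj a b
  xor : ∀ a ∈ B, ∀ b ∈ B, G.Adj a b → Xor (R a b) (R b a)
  acyclic : ∀ v, ¬ Relation.TransGen R v v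

/-- `A` is an independent set of vertices. -/
def IsIndep (G : SimpleGraph V) (A : Finset V) : Prop := ∀ a ∈ A, ∀ b ∈ A, ¬ G.Adj a b

/-- No edge enters `A`, so a path that starts outside `A` stays outside. -/
theorem transGen_restrict {R R' : V → V → Prop} {A : Finset V}
    (h : ∀ x y, R x y → y ∉ A ∧ (x ∉ A → R' x y)) {u v : V} (huv : Relation.TransGen R u v)
    (hu : u ∉ A) : Relation.TransGen R' u v ∧ v ∉ A := by
  induction huv with
  | single h1 => exact ⟨Relation.TransGen.single ((h _ _ h1).2 hu), (h _ _ h1).1⟩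
  | tail _ h1 ih => exact ⟨ih.1.tail ((h _ _ h1).2 ih.2), (h _ _ h1).1⟩

variable [Fintype V]

/-- The number of acyclic orientations of an induced subgraph. -/
def numAcyclic (G : SimpleGraph V) (B : Finset V) : ℚ :=
  #{R : V → V → Prop | IsAcyclicOn G B R}

theorem exists_source {R : V → V → Prop} (h : ∀ v, ¬ Relation.TransGen R v v) {B : Finset V}
    (hB : B.Nonempty) : ∃ m ∈ B, ∀ a ∈ B, ¬ R a m := by
  have : Std.Irrefl (Relation.TransGen R) := ⟨h⟩
  have : IsTrans V (Relation.TransGen R) := ⟨fun _ _ _ => Relation.TransGen.trans⟩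
  obtain ⟨m, hm, hm'⟩ := (Finite.wellFounded_of_trans_of_irrefl
    (Relation.TransGen R)).has_min (B : Set V) hB
  exact ⟨m, hm, fun a ha hR => hm' a ha (Relation.TransGen.single hR)⟩

/-- Adjacent vertices cannot both be sources. If `A` is independent, making all of `A` sources
forces every edge between `A` and the rest to point away from `A`; this creates no cycle, so only
the orientation on `B \ A` is free. -/
theorem card_isAcyclicOn_sdiff (G : SimpleGraph V) {A B : Finset V} (hAB : A ⊆ B) :
    #{R : V → V → Prop | IsAcyclicOn G B R ∧ ∀ a ∈ A, ∀ x, ¬ R x a} =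
      if IsIndep G A then #{R : V → V → Prop | IsAcyclicOn G (B \ A) R} else 0 := by
  split_ifs with hA
  · refine card_bij' (fun R _ x y => R x y ∧ x ∉ A)
      (fun R _ x y => R x y ∨ (x ∈ A ∧ y ∈ B \ A ∧ G.Adj x y)) ?_ ?_ ?_ ?_
    · intro R hR
      simp only [mem_filter, mem_univ, true_and] at hR ⊢
      obtain ⟨hR, hs⟩ := hR
      refine ⟨fun a b h => ?_, fun a ha b hb hab => ?_, fun v hv => ?_⟩
      · have := hR.mem a b h.1
        exact ⟨mem_sdiff.2 ⟨this.1, h.2⟩, mem_sdiff.2 ⟨this.2.1, fun hb => hs b hb a h.1⟩, this.2.2⟩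
      · rw [mem_sdiff] at ha hb
        simpa [ha.2, hb.2] using hR.xor a ha.1 b hb.1 hab
      · exact hR.acyclic v (Relation.TransGen.mono (fun _ _ h => h.1) _ _ hv)
    · intro R hR
      simp only [mem_filter, mem_univ, true_and] at hR ⊢
      have hmem : ∀ {x y}, R x y → x ∉ A ∧ y ∉ A := fun h =>
        ⟨(mem_sdiff.1 (hR.mem _ _ h).1).2, (mem_sdiff.1 (hR.mem _ _ h).2.1).2⟩
      refine ⟨⟨fun a b h => ?_, fun a ha b hb hab => ?_, fun v hv => ?_⟩, fun a ha x hx => ?_⟩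
      · rcases h with h | ⟨h1, h2, h3⟩
        · have := hR.mem a b h
          exact ⟨sdiff_subset this.1, sdiff_subset this.2.1, this.2.2⟩
        · exact ⟨hAB h1, sdiff_subset h2, h3⟩
      · by_cases haA : a ∈ A
        · have hbA : b ∉ A := fun hbA => hA a haA b hbA hab
          exact Or.inl ⟨Or.inr ⟨haA, mem_sdiff.2 ⟨hb, hbA⟩, hab⟩, by
            rintro (h | ⟨h, -⟩)
            · exact (hmem h).2 haA
            · exact hbA h⟩
        · by_cases hbA : b ∈ A
          · exact Or.inr ⟨Or.inr ⟨hbA, mem_sdiff.2 ⟨ha, haA⟩, hab.symm⟩, by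
              rintro (h | ⟨h, -⟩)
              · exact (hmem h).2 hbA
              · exact haA h⟩
          · have := hR.xor a (mem_sdiff.2 ⟨ha, haA⟩) b (mem_sdiff.2 ⟨hb, hbA⟩) hab
            simpa [haA, hbA] using this
      · have hstep : ∀ x y, R x y ∨ (x ∈ A ∧ y ∈ B \ A ∧ G.Adj x y) → y ∉ A ∧ (x ∉ A → R x y) := by
          rintro x y (h | ⟨h1, h2, -⟩)
          · exact ⟨(hmem h).2, fun _ => h⟩
          · exact ⟨(mem_sdiff.1 h2).2, fun h => absurd h1 h⟩
        have hvA : v ∉ A := by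
          rcases hv with h | ⟨_, h⟩ <;> exact (hstep _ _ h).1
        exact hR.acyclic v (transGen_restrict hstep hv hvA).1
      · rcases hx with h | ⟨-, h, -⟩
        · exact (hmem h).2 ha
        · exact (mem_sdiff.1 h).2 ha
    · intro R hR
      simp only [mem_filter, mem_univ, true_and] at hR
      obtain ⟨hR, hs⟩ := hR
      funext x y
      refine propext ⟨?_, fun h => ?_⟩
      · rintro (h | ⟨h1, h2, h3⟩)
        · exact h.1
        · rw [mem_sdiff] at h2
          rcases hR.xor x (hAB h1) y h2.1 h3 with h | h
          · exact h.1
          · exact absurd h.1 (hs x h1 y)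
      · by_cases hx : x ∈ A
        · have := hR.mem x y h
          exact Or.inr ⟨hx, mem_sdiff.2 ⟨this.2.1, fun hy => hs y hy x h⟩, this.2.2⟩
        · exact Or.inl ⟨h, hx⟩
    · intro R hR
      simp only [mem_filter, mem_univ, true_and] at hR
      funext x y
      refine propext ⟨?_, fun h => ?_⟩
      · rintro ⟨h | h, hx⟩
        · exact h
        · exact absurd h.1 hx
      · exact ⟨Or.inl h, (mem_sdiff.1 (hR.mem x y h).1).2⟩
  · rw [card_eq_zero, filter_eq_empty_iff]
    rintro R - ⟨hR, hs⟩
    refine hA fun a ha b hb hab => ?_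
    rcases hR.xor a (hAB ha) b (hAB hb) hab with h | h
    · exact hs b hb a h.1
    · exact hs a ha b h.1

/-- The sum counts pairs of an acyclic orientation of `B` and a set `A` of its sources, signed by
`|A|`. For a fixed orientation it is the alternating sum over all subsets of the set of sources,
which is nonempty. -/
theorem signedInverse_numAcyclic (G : SimpleGraph V) :
    SignedInverse (fun A => if IsIndep G A then (1 : ℚ) else 0) (numAcyclic G) where
  left_empty := by simp [IsIndep]
  right_empty := by
    rw [numAcyclic]
    norm_cast
    rw [card_eq_one]
    refine ⟨fun _ _ => False, ?_⟩
    ext R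
    simp only [mem_filter, mem_univ, true_and, mem_singleton]
    constructor
    · intro h
      funext a b
      exact propext ⟨fun hR => absurd (h.mem a b hR).1 (notMem_empty a), False.elim⟩
    · rintro rfl
      refine ⟨fun a b h => h.elim, fun a ha => absurd ha (notMem_empty a), fun v hv => ?_⟩
      rcases hv with h | ⟨_, h⟩ <;> exact h
  sum_eq_zero B hB := by
    have e : ∀ A ∈ B.powerset, (-1 : ℚ) ^ A.card * (if IsIndep G A then (1 : ℚ) else 0) *
        numAcyclic G (B \ A) = ∑ R ∈ ({R | IsAcyclicOn G B R} : Finset (V → V → Prop)),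
          if ∀ a ∈ A, ∀ x, ¬ R x a then (-1 : ℚ) ^ A.card else 0 := by
      intro A hA
      rw [← sum_filter, filter_filter, sum_const, nsmul_eq_mul,
        card_isAcyclicOn_sdiff G (mem_powerset.1 hA), numAcyclic]
      split_ifs <;> simp [mul_comm]
    rw [sum_congr rfl e, sum_comm]
    refine sum_eq_zero fun R hR => ?_
    simp only [mem_filter, mem_univ, true_and] at hR
    rw [← sum_filter]
    have hs : ({A ∈ B.powerset | ∀ a ∈ A, ∀ x, ¬ R x a} : Finset (Finset V)) =
        ({a ∈ B | ∀ x, ¬ R x a} : Finset V).powerset := by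
      ext A
      simp only [mem_filter, mem_powerset, subset_iff]
      exact ⟨fun h a ha => ⟨h.1 ha, h.2 a ha⟩, fun h => ⟨fun a ha => (h ha).1, fun a ha => (h ha).2⟩⟩
    obtain ⟨m, hm, hm'⟩ := exists_source hR.acyclic hB
    have hne : ({a ∈ B | ∀ x, ¬ R x a} : Finset V).Nonempty :=
      ⟨m, mem_filter.2 ⟨hm, fun x hx => hm' x (hR.mem x m hx).1 hx⟩⟩
    rw [hs]
    have := sum_powerset_neg_one_pow_card_of_nonempty hne
    exact_mod_cast this

theorem natCard_acyclicOrientation (G : SimpleGraph V) (B : Finset V) :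
    (Nat.card (AcyclicOrientation (G.induce (B : Set V))) : ℚ) = numAcyclic G B := by
  rw [numAcyclic, Nat.cast_inj, ← Nat.subtype_card (p := IsAcyclicOn G B) _ (by simp)]
  have hext : ∀ (O : Digraph (B : Set V)), ∀ {u v},
      Relation.TransGen (fun x y => ∃ hx hy, O.Adj ⟨x, hx⟩ ⟨y, hy⟩) u v →
      ∃ hu hv, Relation.TransGen O.Adj ⟨u, hu⟩ ⟨v, hv⟩ := by
    intro O u v h
    induction h with
    | single h =>
      obtain ⟨hx, hy, h⟩ := h
      exact ⟨hx, hy, Relation.TransGen.single h⟩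
    | tail _ h ih =>
      obtain ⟨hx, hy, h⟩ := h
      obtain ⟨hu, hv, ih⟩ := ih
      exact ⟨hu, hy, ih.tail h⟩
  refine Nat.card_congr ⟨fun O => ⟨fun x y => ∃ hx hy, O.1.Adj ⟨x, hx⟩ ⟨y, hy⟩, ?_⟩,
    fun R => ⟨⟨fun a b => R.1 a b⟩, ?_⟩, ?_, ?_⟩
  · obtain ⟨O, ⟨h1, h2⟩, h3⟩ := O
    refine ⟨fun a b => ?_, fun a ha b hb hab => ?_, fun v hv => ?_⟩
    · rintro ⟨ha, hb, h⟩
      exact ⟨ha, hb, h1 _ _ h⟩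
    · rcases h2 ⟨a, ha⟩ ⟨b, hb⟩ hab with h | h
      · exact Or.inl ⟨⟨ha, hb, h.1⟩, fun ⟨_, _, h'⟩ => h.2 h'⟩
      · exact Or.inr ⟨⟨hb, ha, h.1⟩, fun ⟨_, _, h'⟩ => h.2 h'⟩
    · obtain ⟨_, _, h⟩ := hext O hv
      exact h3 _ h
  · obtain ⟨R, h⟩ := R
    refine ⟨⟨fun a b hab => (h.mem a b hab).2.2, fun a b hab => h.xor a a.2 b b.2 hab⟩,
      fun v hv => h.acyclic v ?_⟩
    exact Relation.TransGen.lift Subtype.val (fun _ _ h => h) _ _ hv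
  · rintro ⟨O, hO⟩
    refine Subtype.ext (Digraph.ext ?_)
    funext a b
    exact propext ⟨fun ⟨_, _, h⟩ => h, fun h => ⟨a.2, b.2, h⟩⟩
  · rintro ⟨R, hR⟩
    refine Subtype.ext ?_
    funext x y
    exact propext ⟨fun ⟨_, _, h⟩ => h, fun h => ⟨(hR.mem x y h).1, (hR.mem x y h).2.1, h⟩⟩

end ChromTrace
end

noncomputable section
open scoped Classical
open Finset
namespace ChromTrace

/-! ### Words without descents -/

variable {V : Type*}

/-- `l` lists the elements of `B` once each, and no two consecutive elements are `D`-related. -/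
structure IsWord (D : V → V → Prop) (B : Finset V) (l : List V) : Prop where
  nodup : l.Nodup
  mem_iff : ∀ x, x ∈ l ↔ x ∈ B
  isChain : l.IsChain fun a b => ¬ D a b

/-- The finitely many words. -/
def words (D : V → V → Prop) (B : Finset V) : Finset (List V) :=
  {l ∈ B.val.lists.toFinset | IsWord D B l}

theorem mem_words {D : V → V → Prop} {B : Finset V} {l : List V} :
    l ∈ words D B ↔ IsWord D B l := by
  rw [words, mem_filter, and_iff_right_iff_imp, Multiset.mem_toFinset, Multiset.mem_lists_iff]
  intro h
  exact (Multiset.Nodup.ext B.nodup (Multiset.coe_nodup.2 h.nodup)).2 fun x => (h.mem_iff x).symm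

theorem isWord_nil {D : V → V → Prop} : IsWord D ∅ [] := ⟨List.nodup_nil, by simp, List.isChain_nil⟩

theorem IsWord.eq_empty {D : V → V → Prop} {B : Finset V} (h : IsWord D B []) : B = ∅ :=
  eq_empty_of_forall_notMem fun x hx => List.not_mem_nil ((h.mem_iff x).2 hx)

theorem IsWord.tail {D : V → V → Prop} {B : Finset V} {x : V} {l : List V}
    (h : IsWord D B (x :: l)) : IsWord D (B.erase x) l where
  nodup := (List.nodup_cons.1 h.nodup).2
  mem_iff y := by
    rw [mem_erase, ← h.mem_iff, List.mem_cons]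
    have := (List.nodup_cons.1 h.nodup).1
    constructor
    · exact fun hy => ⟨fun e => this (e ▸ hy), Or.inr hy⟩
    · exact fun hy => hy.2.resolve_left hy.1
  isChain := h.isChain.tail

theorem IsWord.cons {D : V → V → Prop} {B : Finset V} {x : V} {l : List V}
    (h : IsWord D B l) (hx : x ∉ B) (hD : ∀ y ∈ l.head?, ¬ D x y) : IsWord D (insert x B) (x :: l) where
  nodup := List.nodup_cons.2 ⟨fun h' => hx ((h.mem_iff x).1 h'), h.nodup⟩
  mem_iff y := by rw [List.mem_cons, mem_insert, h.mem_iff]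
  isChain := List.isChain_cons.2 ⟨hD, h.isChain⟩

/-! ### The sign-reversing involution on chains and descent-free words -/

variable {P : Type*} [PartialOrder P]

theorem isIndep_inc_iff {A : Finset P} :
    IsIndep (inc P) A ↔ ∀ a ∈ A, ∀ b ∈ A, a ≤ b ∨ b ≤ a := by
  refine forall₄_congr fun a _ b _ => ?_
  change ¬ (¬ a ≤ b ∧ ¬ b ≤ a) ↔ _
  tauto

theorem exists_le_of_isIndep_inc {A : Finset P} (h : IsIndep (inc P) A) (hA : A.Nonempty) :
    ∃ m ∈ A, ∀ a ∈ A, m ≤ a := by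
  obtain ⟨m, hm⟩ := A.exists_minimal hA
  refine ⟨m, hm.1, fun a ha => ?_⟩
  rcases isIndep_inc_iff.1 h m hm.1 a ha with h | h
  · exact h
  · exact hm.2 ha h

/-- The first letter of the word `l` is below all elements of `A`. -/
def IsMovable (A : Finset P) (l : List P) : Prop := ∃ x l', l = x :: l' ∧ ∀ a ∈ A, x < a

/-- Move the first letter of a word to a chain, or the least element of a chain to a word. -/
def toggle (p : Σ _ : Finset P, List P) : Σ _ : Finset P, List P :=
  if h : IsMovable p.1 p.2 then ⟨insert h.choose p.1, h.choose_spec.choose⟩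
  else if h : ∃ m ∈ p.1, ∀ a ∈ p.1, m ≤ a then ⟨p.1.erase h.choose, h.choose :: p.2⟩
  else p

theorem toggle_of_lt {A : Finset P} {x : P} {l : List P} (h : ∀ a ∈ A, x < a) :
    toggle ⟨A, x :: l⟩ = ⟨insert x A, l⟩ := by
  have hm : IsMovable A (x :: l) := ⟨x, l, rfl, h⟩
  rw [toggle, dif_pos hm]
  have e := hm.choose_spec.choose_spec.1
  rw [List.cons.injEq] at e
  exact congrArg₂ (fun a b => (⟨insert a A, b⟩ : Σ _ : Finset P, List P)) e.1.symm e.2.symm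

theorem toggle_of_le {A : Finset P} {m : P} {l : List P} (hm : m ∈ A) (h : ∀ a ∈ A, m ≤ a)
    (hl : ¬ IsMovable A l) : toggle ⟨A, l⟩ = ⟨A.erase m, m :: l⟩ := by
  have hex : ∃ m ∈ A, ∀ a ∈ A, m ≤ a := ⟨m, hm, h⟩
  rw [toggle, dif_neg hl, dif_pos hex]
  rw [le_antisymm (hex.choose_spec.2 m hm) (h _ hex.choose_spec.1)]

/-- The number of words without descents on a subset of a poset. -/
def numDescentFree (B : Finset P) : ℚ := #(words (fun a b : P => a > b) B)

/-- Independent sets of `inc P` are chains, so the terms are pairs of a chain `A` and a descent-free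
word on `B \ A`. Moving the first letter into the chain when it lies below it, and otherwise the
least element of the chain to the front of the word, changes `|A|` by one and is an involution. -/
theorem signedInverse_numDescentFree :
    SignedInverse (fun A => if IsIndep (inc P) A then (1 : ℚ) else 0) numDescentFree where
  left_empty := by simp [IsIndep]
  right_empty := by
    rw [numDescentFree]
    norm_cast
    rw [card_eq_one]
    refine ⟨[], ?_⟩
    ext l
    rw [mem_words, mem_singleton]
    constructor
    · intro h
      exact List.eq_nil_iff_forall_not_mem.2 fun x hx => notMem_empty x ((h.mem_iff x).1 hx)
    · rintro rfl
      exact isWord_nil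
  sum_eq_zero B hB := by
    have e : ∀ A ∈ B.powerset, (-1 : ℚ) ^ A.card * (if IsIndep (inc P) A then (1 : ℚ) else 0) *
        numDescentFree (B \ A) = ∑ l ∈ words (fun a b : P => a > b) (B \ A),
          if IsIndep (inc P) A then (-1 : ℚ) ^ A.card else 0 := by
      intro A _
      rw [sum_const, nsmul_eq_mul, numDescentFree]
      split_ifs <;> simp [mul_comm]
    rw [sum_congr rfl e, sum_sigma', ← sum_filter]
    have hmem : ∀ (A : Finset P) (l : List P), (⟨A, l⟩ : Σ _ : Finset P, List P) ∈
        ({x ∈ B.powerset.sigma fun A => words (fun a b : P => a > b) (B \ A) |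
          IsIndep (inc P) x.1} : Finset (Σ _ : Finset P, List P)) ↔
        A ⊆ B ∧ IsWord (fun a b : P => a > b) (B \ A) l ∧ IsIndep (inc P) A := by
      intro A l
      rw [mem_filter, mem_sigma, mem_powerset, mem_words, and_assoc]
    -- Every pair is a member of a couple `(A', x :: l')`, `(insert x A', l')` in which only the
    -- first member has a movable letter.
    have key : ∀ (A : Finset P) (l : List P), A ⊆ B →
        IsWord (fun a b : P => a > b) (B \ A) l → IsIndep (inc P) A →
        ∃ (x : P) (A' : Finset P) (l' : List P), x ∉ A' ∧ insert x A' ⊆ B ∧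
          (∀ a ∈ A', x < a) ∧ ¬ IsMovable (insert x A') l' ∧
          IsWord (fun a b : P => a > b) (B \ A') (x :: l') ∧
          IsWord (fun a b : P => a > b) (B \ insert x A') l' ∧ IsIndep (inc P) A' ∧
          IsIndep (inc P) (insert x A') ∧
          ((A = A' ∧ l = x :: l') ∨ (A = insert x A' ∧ l = l')) := by
      intro A l hAB hl hA
      by_cases hmov : IsMovable A l
      · obtain ⟨x, l', rfl, hx⟩ := hmov
        have hxA : x ∉ A := fun h => lt_irrefl _ (hx x h)
        have hxB : x ∈ B \ A := (hl.mem_iff x).1 List.mem_cons_self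
        refine ⟨x, A, l', hxA, insert_subset (mem_sdiff.1 hxB).1 hAB, hx, ?_, hl, ?_, hA, ?_,
          Or.inl ⟨rfl, rfl⟩⟩
        · rintro ⟨y, l'', rfl, hy⟩
          -- After `x` has moved, a movable next letter `y` would satisfy `y < x`, a descent of the
          -- word.
          exact (List.isChain_cons_cons.1 hl.isChain).1 (hy x (mem_insert_self _ _))
        · rw [sdiff_insert]
          exact hl.tail
        · rw [isIndep_inc_iff] at hA ⊢
          intro a ha b hb
          rcases mem_insert.1 ha with rfl | ha' <;> rcases mem_insert.1 hb with rfl | hb'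
          · exact Or.inl le_rfl
          · exact Or.inl (hx b hb').le
          · exact Or.inr (hx a ha').le
          · exact hA a ha' b hb'
      · have hne : A.Nonempty := by
          by_contra hne
          rw [not_nonempty_iff_eq_empty] at hne
          subst hne
          rcases l with _ | ⟨x, l⟩
          · have := hl.eq_empty
            rw [sdiff_empty] at this
            exact hB.ne_empty this
          · exact hmov ⟨x, l, rfl, by simp⟩
        obtain ⟨m, hm, hle⟩ := exists_le_of_isIndep_inc hA hne
        have hins : insert m (A.erase m) = A := insert_erase hm
        have hlt : ∀ a ∈ A.erase m, m < a := fun a ha =>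
          lt_of_le_of_ne (hle a (mem_of_mem_erase ha)) (ne_of_mem_erase ha).symm
        refine ⟨m, A.erase m, l, notMem_erase m A, ?_, hlt, ?_, ?_, ?_, ?_, ?_,
          Or.inr ⟨hins.symm, rfl⟩⟩
        · rwa [hins]
        · rwa [hins]
        · have h1 : B \ A.erase m = insert m (B \ A) := by
            rw [sdiff_erase (hAB hm)]
          rw [h1]
          -- A descent from `m` to the first letter `y` would put `y` below all of `A`, making it
          -- movable.
          refine hl.cons (fun h => (mem_sdiff.1 h).2 hm) fun y hy hmy => hmov ?_
          obtain ⟨l', rfl⟩ : ∃ l', l = y :: l' := List.head?_eq_some_iff.1 hy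
          exact ⟨y, l', rfl, fun a ha => lt_of_lt_of_le hmy (hle a ha)⟩
        · rwa [hins]
        · exact fun a ha b hb => hA a (mem_of_mem_erase ha) b (mem_of_mem_erase hb)
        · rwa [hins]
    have htog : ∀ (x : P) (A' : Finset P) (l' : List P), x ∉ A' → (∀ a ∈ A', x < a) →
        ¬ IsMovable (insert x A') l' → toggle ⟨A', x :: l'⟩ = ⟨insert x A', l'⟩ ∧
          toggle ⟨insert x A', l'⟩ = ⟨A', x :: l'⟩ := by
      intro x A' l' hx hlt hmov
      refine ⟨toggle_of_lt hlt, ?_⟩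
      rw [toggle_of_le (mem_insert_self x A') _ hmov, erase_insert hx]
      intro a ha
      rcases mem_insert.1 ha with rfl | ha
      · exact le_rfl
      · exact (hlt a ha).le
    refine sum_involution (fun p _ => toggle p) ?_ ?_ ?_ ?_
    · rintro ⟨A, l⟩ hp
      obtain ⟨h1, h2, h3⟩ := (hmem A l).1 hp
      obtain ⟨x, A', l', hx, -, hlt, hmov, -, -, -, -, ⟨rfl, rfl⟩ | ⟨rfl, rfl⟩⟩ := key A l h1 h2 h3
      · rw [(htog x A l' hx hlt hmov).1, card_insert_of_notMem hx]
        ring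
      · rw [(htog x A' l hx hlt hmov).2, card_insert_of_notMem hx]
        ring
    · rintro ⟨A, l⟩ hp _ heq
      obtain ⟨h1, h2, h3⟩ := (hmem A l).1 hp
      obtain ⟨x, A', l', hx, -, hlt, hmov, -, -, -, -, ⟨rfl, rfl⟩ | ⟨rfl, rfl⟩⟩ := key A l h1 h2 h3
      · rw [(htog x A l' hx hlt hmov).1] at heq
        exact hx (insert_eq_self.1 (congrArg Sigma.fst heq))
      · rw [(htog x A' l hx hlt hmov).2] at heq
        exact hx (insert_eq_self.1 (congrArg Sigma.fst heq).symm)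
    · rintro ⟨A, l⟩ hp
      obtain ⟨h1, h2, h3⟩ := (hmem A l).1 hp
      obtain ⟨x, A', l', hx, hB', hlt, hmov, w1, w2, i1, i2, ⟨rfl, rfl⟩ | ⟨rfl, rfl⟩⟩ :=
        key A l h1 h2 h3
      · rw [(htog x A l' hx hlt hmov).1, hmem]
        exact ⟨hB', w2, i2⟩
      · rw [(htog x A' l hx hlt hmov).2, hmem]
        exact ⟨(subset_insert x A').trans hB', w1, i1⟩
    · rintro ⟨A, l⟩ hp
      obtain ⟨h1, h2, h3⟩ := (hmem A l).1 hp
      obtain ⟨x, A', l', hx, -, hlt, hmov, -, -, -, -, ⟨rfl, rfl⟩ | ⟨rfl, rfl⟩⟩ := key A l h1 h2 h3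
      · rw [(htog x A l' hx hlt hmov).1, (htog x A l' hx hlt hmov).2]
      · rw [(htog x A' l hx hlt hmov).2, (htog x A' l hx hlt hmov).1]

end ChromTrace
end

noncomputable section
open scoped Classical
open Finset
namespace ChromTrace

universe u

/-! ### Words and permutations -/

/-- The words listing all elements of a type, without `D`-related consecutive letters. -/
abbrev WordsAvoiding {α : Type*} (D : α → α → Prop) : Type _ :=
  {l : List α // l.Nodup ∧ (∀ x, x ∈ l) ∧ l.IsChain fun a b => ¬ D a b}

/-- The permutations that never move an element to a `D`-related one. -/
abbrev PermsAvoiding {α : Type*} (D : α → α → Prop) : Type _ :=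
  {τ : Equiv.Perm α // ∀ x, ¬ D x (τ x)}

section Transport

variable {α β : Type*}

theorem isWordAvoiding_map (e : α ≃ β) (D : β → β → Prop) (l : List α) :
    ((l.map e).Nodup ∧ (∀ x, x ∈ l.map e) ∧ (l.map e).IsChain fun a b => ¬ D a b) ↔
      (l.Nodup ∧ (∀ x, x ∈ l) ∧ l.IsChain fun a b => ¬ D (e a) (e b)) := by
  refine and_congr (List.nodup_map_iff e.injective) (and_congr ?_ (List.isChain_map e))
  exact ⟨fun h x => (List.mem_map_of_injective e.injective).1 (h (e x)), fun h x =>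
    List.mem_map.2 ⟨e.symm x, h _, e.apply_symm_apply x⟩⟩

/-- Words are transported along a bijection. -/
def wordsCongr (e : α ≃ β) (D : β → β → Prop) :
    WordsAvoiding (fun a b => D (e a) (e b)) ≃ WordsAvoiding D where
  toFun l := ⟨l.1.map e, (isWordAvoiding_map e D l.1).2 l.2⟩
  invFun l := ⟨l.1.map e.symm, (isWordAvoiding_map e D _).1 (by simpa using l.2)⟩
  left_inv l := by simp
  right_inv l := by simp

/-- Permutations are transported along a bijection. -/
def permsCongr (e : α ≃ β) (D : β → β → Prop) :
    PermsAvoiding (fun a b => D (e a) (e b)) ≃ PermsAvoiding D :=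
  e.permCongr.subtypeEquiv fun τ => by
    rw [← e.forall_congr_right]
    simp

end Transport

section Step

variable {β : Type*}

/-- The relation on `β` obtained from one on `Option β` by allowing all steps to `y`. -/
def allow (D : Option β → Option β → Prop) (y : Option β) (b c : β) : Prop :=
  D (some b) (some c) ∧ some c ≠ y

/-- Removing `none` from its cycle joins its predecessor to `σ none`. The step into `none` was never
forbidden, so the new step into `σ none` must be unrestricted: this is what `allow` grants. -/
theorem permsAvoiding_option_iff {D : Option β → Option β → Prop} (hD : ∀ x, ¬ D x none)
    (σ : Equiv.Perm (Option β)) :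
    (∀ x, ¬ D x (σ x)) ↔ ¬ D none (σ none) ∧
      ∀ b, ¬ allow D (σ none) b (Equiv.removeNone σ b) := by
  have h : ∀ b, ¬ D (some b) (σ (some b)) ↔ ¬ allow D (σ none) b (Equiv.removeNone σ b) := by
    intro b
    rcases hb : σ (some b) with _ | c
    · simp [allow, Equiv.removeNone_none σ hb, hD]
    · have hc : some (Equiv.removeNone σ b) = some c := by
        rw [Equiv.removeNone_some σ ⟨c, hb⟩, hb]
      have hne : some c ≠ σ none := by
        rw [← hb]
        exact fun h => by simpa using σ.injective h
      rw [allow, hc]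
      simp [hne]
  rw [Option.forall, forall_congr' h]

/-- Removing `none` from the cycle containing it. -/
def permsOptionEquiv {D : Option β → Option β → Prop} (hD : ∀ x, ¬ D x none) :
    PermsAvoiding D ≃ Σ y : Option β,
      {τ : Equiv.Perm β // ¬ D none y ∧ ∀ b, ¬ allow D y b (τ b)} :=
  (Equiv.Perm.decomposeOption.subtypeEquiv (q := fun p : Option β × Equiv.Perm β =>
    ¬ D none p.1 ∧ ∀ b, ¬ allow D p.1 b (p.2 b)) (permsAvoiding_option_iff hD)).trans
    (Equiv.subtypeProdEquivSigmaSubtype fun y (τ : Equiv.Perm β) =>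
      ¬ D none y ∧ ∀ b, ¬ allow D y b (τ b))

theorem exists_map_some {l : List (Option β)} (h : none ∉ l) : ∃ u : List β, l = u.map some := by
  induction l with
  | nil => exact ⟨[], rfl⟩
  | cons a l ih =>
    rw [List.mem_cons, not_or] at h
    obtain ⟨u, rfl⟩ := ih h.2
    rcases a with _ | a
    · exact absurd rfl h.1
    · exact ⟨a :: u, rfl⟩

/-- The words on `β` cut into two parts. -/
def IsCutWord (D : Option β → Option β → Prop) (p : List β × List β) : Prop :=
  (p.1 ++ p.2).Nodup ∧ (∀ x, x ∈ p.1 ++ p.2) ∧ ¬ D none p.2.head? ∧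
    (p.1.IsChain fun a b => ¬ D (some a) (some b)) ∧ p.2.IsChain fun a b => ¬ D (some a) (some b)

/-- Any letter may precede `none`, so inserting it at the cut only constrains the letter that
follows. -/
theorem isWord_insert_none_iff {D : Option β → Option β → Prop} (hD : ∀ x, ¬ D x none)
    (u v : List β) :
    ((u.map some ++ none :: v.map some).Nodup ∧ (∀ x, x ∈ u.map some ++ none :: v.map some) ∧
      (u.map some ++ none :: v.map some).IsChain fun a b => ¬ D a b) ↔ IsCutWord D (u, v) := by
  have h1 : (u.map some ++ none :: v.map some).Nodup ↔ (u ++ v).Nodup := by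
    rw [List.nodup_middle, List.nodup_cons, ← List.map_append,
      List.nodup_map_iff (Option.some_injective β)]
    simp
  have h2 : (∀ x, x ∈ u.map some ++ none :: v.map some) ↔ ∀ x, x ∈ u ++ v := by
    rw [Option.forall]
    simp
  rw [IsCutWord, h1, h2, List.isChain_append, List.isChain_cons, List.isChain_map, List.isChain_map]
  refine and_congr_right fun _ => and_congr_right fun _ => ?_
  have h3 : (∀ y ∈ (v.map some).head?, ¬ D none y) ↔ ¬ D none v.head? := by
    rcases v with _ | ⟨a, v⟩ <;> simp [hD]
  rw [h3]
  simp only [List.head?_cons, Option.mem_some_iff, forall_eq', hD, not_false_eq_true, implies_true,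
    and_true]
  tauto

/-- Gluing at the cut creates one new step, into the first letter of `v`, which `allow` exempts. As
that letter occurs once, no other step is affected. -/
theorem isWord_append_iff {D : Option β → Option β → Prop} (u v : List β) :
    (¬ D none v.head? ∧ (u ++ v).Nodup ∧ (∀ x, x ∈ u ++ v) ∧
      (u ++ v).IsChain fun a b => ¬ allow D v.head? a b) ↔ IsCutWord D (u, v) := by
  have h : (u ++ v).Nodup → (((u ++ v).IsChain fun a b => ¬ allow D v.head? a b) ↔
      ((u.IsChain fun a b => ¬ D (some a) (some b)) ∧
        v.IsChain fun a b => ¬ D (some a) (some b))) := by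
    intro hn
    rw [List.nodup_append] at hn
    obtain ⟨-, hv, huv⟩ := hn
    rw [List.isChain_append]
    refine and_congr ?_ ?_
    · refine List.IsChain.iff_of_mem_imp fun a b ha hb => not_congr ?_
      rw [allow, and_iff_left_iff_imp]
      rintro - h
      exact huv b hb b (List.mem_of_mem_head? h.symm) rfl
    · rw [and_iff_left]
      · refine List.IsChain.iff_of_mem_tail_imp fun a b ha hb => not_congr ?_
        rw [allow, and_iff_left_iff_imp]
        rintro - h
        rcases v with _ | ⟨c, v⟩
        · simp at h
        · obtain rfl : b = c := by simpa using h
          exact (List.nodup_cons.1 hv).1 hb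
      · rintro a - b hb ⟨-, h⟩
        exact h hb.symm
  rw [IsCutWord]
  constructor
  · rintro ⟨h1, h2, h3, h4⟩
    exact ⟨h2, h3, h1, (h h2).1 h4⟩
  · rintro ⟨h2, h3, h1, h4⟩
    exact ⟨h1, h2, h3, (h h2).2 h4⟩

/-- The letter after `none` plays the part of `σ none` in `permsOptionEquiv`, with `y = none` when
`none` comes last. Words and permutations thus satisfy the same recursion. -/
theorem nonempty_wordsOptionEquiv {D : Option β → Option β → Prop} (hD : ∀ x, ¬ D x none) :
    Nonempty (WordsAvoiding D ≃ Σ y : Option β,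
      {l : List β // ¬ D none y ∧ l.Nodup ∧ (∀ x, x ∈ l) ∧ l.IsChain fun a b => ¬ allow D y a b}) := by
  have f₁ : {p // IsCutWord D p} ≃ WordsAvoiding D := by
    refine Equiv.ofBijective (fun p => ⟨p.1.1.map some ++ none :: p.1.2.map some,
      (isWord_insert_none_iff hD _ _).2 p.2⟩) ⟨?_, ?_⟩
    · rintro ⟨⟨u, v⟩, h⟩ ⟨⟨u', v'⟩, h'⟩ heq
      have h1 := (List.append_cons_inj_of_notMem (by simp) (by simp)).1 (Subtype.mk.inj heq)
      have h2 := List.map_injective_iff.2 (Option.some_injective β) h1.1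
      have h3 := List.map_injective_iff.2 (Option.some_injective β) h1.2.2
      exact Subtype.ext (Prod.ext h2 h3)
    · rintro ⟨l, hl⟩
      obtain ⟨s, t, rfl⟩ := List.append_of_mem (hl.2.1 none)
      have hn := List.nodup_cons.1 (List.nodup_middle.1 hl.1)
      rw [List.mem_append, not_or] at hn
      obtain ⟨u, rfl⟩ := exists_map_some hn.1.1
      obtain ⟨v, rfl⟩ := exists_map_some hn.1.2
      exact ⟨⟨(u, v), (isWord_insert_none_iff hD u v).1 hl⟩, rfl⟩
  have f₂ : {p // IsCutWord D p} ≃ Σ y : Option β, {l : List β //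
      ¬ D none y ∧ l.Nodup ∧ (∀ x, x ∈ l) ∧ l.IsChain fun a b => ¬ allow D y a b} := by
    refine Equiv.ofBijective (fun p => ⟨p.1.2.head?, p.1.1 ++ p.1.2,
      (isWord_append_iff _ _).2 p.2⟩) ⟨?_, ?_⟩
    · rintro ⟨⟨u, v⟩, h⟩ ⟨⟨u', v'⟩, h'⟩ heq
      rw [Sigma.mk.injEq] at heq
      obtain ⟨hy, hl⟩ := heq
      have hl' : u ++ v = u' ++ v' := by
        have key : ∀ (y y' : Option β) (hyy : y = y') (l l' : List β) (hl₁ : _) (hl₂ : _),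
            HEq (⟨l, hl₁⟩ : {l : List β // ¬ D none y ∧ l.Nodup ∧ (∀ x, x ∈ l) ∧
              l.IsChain fun a b => ¬ allow D y a b})
            (⟨l', hl₂⟩ : {l : List β // ¬ D none y' ∧ l.Nodup ∧ (∀ x, x ∈ l) ∧
              l.IsChain fun a b => ¬ allow D y' a b}) → l = l' := by
          rintro y _ rfl l l' _ _ h
          exact Subtype.mk.inj (eq_of_heq h)
        exact key _ _ hy _ _ _ _ hl
      have hn : (u ++ v).Nodup := h.1
      have hn' : (u' ++ v').Nodup := h'.1
      -- The cut is determined by the glued word and `y`, since letters are distinct.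
      rcases v with _ | ⟨a, v⟩ <;> rcases v' with _ | ⟨a', v'⟩
      · simpa using hl'
      · simp at hy
      · simp at hy
      · obtain rfl : a = a' := by simpa using hy
        rw [List.nodup_middle, List.nodup_cons, List.mem_append, not_or] at hn
        have := (List.append_cons_inj_of_notMem hn.1.1 hn.1.2).1 hl'
        exact Subtype.ext (Prod.ext this.1 (congrArg (List.cons a) this.2.2))
    · rintro ⟨y, l, hl⟩
      rcases y with _ | y
      · refine ⟨⟨(l, []), (isWord_append_iff l []).1 (by simpa using hl)⟩, ?_⟩
        refine Sigma.ext rfl (heq_of_eq (Subtype.ext (List.append_nil l)))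
      · obtain ⟨s, t, rfl⟩ := List.append_of_mem (hl.2.2.1 y)
        exact ⟨⟨(s, y :: t), (isWord_append_iff s (y :: t)).1 hl⟩, rfl⟩
  exact ⟨f₁.symm.trans f₂⟩

end Step

/-- For an acyclic relation, the permutations that never move an element to a related one are
equinumerous with the words without related consecutive letters. -/
theorem nonempty_wordsAvoiding_equiv_permsAvoiding (n : ℕ) :
    ∀ (α : Type u) [Fintype α], Fintype.card α = n → ∀ D : α → α → Prop,
    (∃ r : α → ℕ, ∀ x y, D x y → r y < r x) → Nonempty (WordsAvoiding D ≃ PermsAvoiding D) := by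
  induction n with
  | zero =>
    intro α _ hα D _
    have := Fintype.card_eq_zero_iff.1 hα
    have h1 : Unique (WordsAvoiding D) :=
      ⟨⟨⟨[], List.nodup_nil, fun x => isEmptyElim x, List.isChain_nil⟩⟩, fun l =>
        Subtype.ext (List.eq_nil_iff_forall_not_mem.2 fun x => isEmptyElim x)⟩
    have h2 : Unique (PermsAvoiding D) :=
      ⟨⟨⟨1, fun x => isEmptyElim x⟩⟩, fun τ => Subtype.ext (Subsingleton.elim _ _)⟩
    exact ⟨Equiv.ofUnique _ _⟩
  | succ n ih =>
    intro α _ hα D ⟨r, hr⟩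
    have hne : Nonempty α := Fintype.card_pos_iff.1 (by omega)
    -- Steps of `D` lower the rank, so no element is `D`-related to one of maximal rank; this
    -- element plays the part of `none`.
    obtain ⟨a, ha⟩ := Finite.exists_max r
    let e := Equiv.optionSubtypeNe a
    have he : e none = a := by simp [e]
    have hD : ∀ x, ¬ D (e x) (e none) := fun x h => by
      rw [he] at h
      exact absurd (hr _ _ h) (not_lt.2 (ha _))
    have hcard : Fintype.card {b // b ≠ a} = n := by
      have := Fintype.card_congr e
      rw [Fintype.card_option, hα] at this
      omega
    obtain ⟨f⟩ := nonempty_wordsOptionEquiv (D := fun x y => D (e x) (e y)) hD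
    have g : ∀ y : Option {b // b ≠ a},
        {l : List {b // b ≠ a} // ¬ D (e none) (e y) ∧ l.Nodup ∧ (∀ x, x ∈ l) ∧
          l.IsChain fun b c => ¬ allow (fun x y => D (e x) (e y)) y b c} ≃
        {τ : Equiv.Perm {b // b ≠ a} // ¬ D (e none) (e y) ∧
          ∀ b, ¬ allow (fun x y => D (e x) (e y)) y b (τ b)} := by
      intro y
      by_cases hy : D (e none) (e y)
      · have h1 : IsEmpty {l : List {b // b ≠ a} // ¬ D (e none) (e y) ∧ l.Nodup ∧ (∀ x, x ∈ l) ∧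
          l.IsChain fun b c => ¬ allow (fun x y => D (e x) (e y)) y b c} := ⟨fun l => l.2.1 hy⟩
        have h2 : IsEmpty {τ : Equiv.Perm {b // b ≠ a} // ¬ D (e none) (e y) ∧
          ∀ b, ¬ allow (fun x y => D (e x) (e y)) y b (τ b)} := ⟨fun l => l.2.1 hy⟩
        exact Equiv.equivOfIsEmpty _ _
      -- `allow` only deletes pairs from `D`, so the same rank function serves. It need not come
      -- from an order, which is why the induction is over acyclic relations.
      · have h := ih {b // b ≠ a} hcard (allow (fun x y => D (e x) (e y)) y)
          ⟨fun b => r (e (some b)), fun b c h => hr _ _ h.1⟩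
        exact (Equiv.subtypeEquivRight fun l => and_iff_right hy).trans
          (h.some.trans (Equiv.subtypeEquivRight fun l => (and_iff_right hy).symm))
    exact ⟨(wordsCongr e D).symm.trans (f.trans ((Equiv.sigmaCongrRight g).trans
      ((permsOptionEquiv hD).symm.trans (permsCongr e D))))⟩

end ChromTrace
end

noncomputable section
open scoped Classical
open Finset
namespace ChromTrace

/-! ### Rows of tableaux -/

section Rows

variable {P : Type*}

/-- The rows of length `k` that list the elements of `B` once each and satisfy `p`. -/
abbrev Row {k : ℕ} (p : (Fin k → P) → Prop) (B : Finset P) : Type _ :=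
  {w : Fin k → P // Function.Injective w ∧ univ.image w = B ∧ p w}

/-- A word in `B` without `D`-related consecutive letters is a row without `D`-related consecutive
entries. -/
theorem natCard_row_chain (D : P → P → Prop) {k : ℕ} {B : Finset P} (hB : B.card = k) :
    Nat.card (Row (k := k) (fun w => ∀ j j' : Fin k, (j' : ℕ) = j + 1 → ¬ D (w j) (w j')) B) =
      #(words D B) := by
  rw [← Nat.subtype_card (words D B) fun l => mem_words]
  have key : ∀ w : Fin k → P, Function.Injective w ∧ univ.image w = B ∧
      (∀ j j' : Fin k, (j' : ℕ) = j + 1 → ¬ D (w j) (w j')) → IsWord D B (List.ofFn w) := by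
    rintro w ⟨hw, rfl, hD⟩
    refine ⟨List.nodup_ofFn.2 hw, fun x => by simp [List.mem_ofFn'], ?_⟩
    rw [List.isChain_iff_getElem]
    intro i hi
    rw [List.length_ofFn] at hi
    simpa using hD ⟨i, by omega⟩ ⟨i + 1, hi⟩ rfl
  refine Nat.card_congr (Equiv.ofBijective (fun w => ⟨List.ofFn w.1, key w.1 w.2⟩) ⟨?_, ?_⟩)
  · intro w w' h
    exact Subtype.ext (List.ofFn_injective (Subtype.mk.inj h))
  · rintro ⟨l, hl⟩
    have hlB : l.toFinset = B := by
      ext x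
      rw [List.mem_toFinset, hl.mem_iff]
    obtain rfl : l.length = k := by
      rw [← hB, ← hlB, List.toFinset_card_of_nodup hl.nodup]
    refine ⟨⟨l.get, List.nodup_iff_injective_get.1 hl.nodup, ?_, ?_⟩,
      Subtype.ext (List.ofFn_get l)⟩
    · ext x
      rw [← hl.mem_iff, List.mem_iff_get, mem_image]
      simp only [mem_univ, true_and]
    · rintro ⟨j, hj⟩ ⟨j', hj'⟩ h
      obtain rfl : j' = j + 1 := h
      exact List.isChain_iff_getElem.1 hl.isChain j hj'

/-- Words in the letters `B` are the words listing all elements of `B` as a type. -/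
theorem card_words_eq (D : P → P → Prop) (B : Finset P) :
    #(words D B) = Nat.card (WordsAvoiding fun x y : B => D x y) := by
  rw [← Nat.subtype_card (words D B) fun l => mem_words]
  have key : ∀ l : List B, (l.Nodup ∧ (∀ x, x ∈ l) ∧ l.IsChain fun a b : B => ¬ D a b) →
      IsWord D B (l.map Subtype.val) := fun l hl =>
    ⟨(List.nodup_map_iff Subtype.val_injective).2 hl.1, fun x => by
      rw [List.mem_map]
      exact ⟨fun ⟨y, _, hy⟩ => hy ▸ y.2, fun hx => ⟨⟨x, hx⟩, hl.2.1 _, rfl⟩⟩,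
      (List.isChain_map Subtype.val).2 hl.2.2⟩
  refine (Nat.card_congr (Equiv.ofBijective (fun l => ⟨l.1.map Subtype.val, key l.1 l.2⟩)
    ⟨?_, ?_⟩)).symm
  · intro l l' h
    exact Subtype.ext (List.map_injective_iff.2 Subtype.val_injective (Subtype.mk.inj h))
  · rintro ⟨l, hl⟩
    lift l to List B using fun x hx => (hl.mem_iff x).1 hx
    refine ⟨⟨l, (List.nodup_map_iff Subtype.val_injective).1 hl.nodup, fun x => ?_,
      (List.isChain_map Subtype.val).1 hl.isChain⟩, rfl⟩
    exact (List.mem_map_of_injective Subtype.val_injective).1 ((hl.mem_iff x).2 x.2)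

/-- Rows whose entries are never `D`-related to the corresponding entries of a fixed listing `s`. -/
theorem natCard_row_listing (D : P → P → Prop) {k : ℕ} {B : Finset P} (s : Fin k ≃ B) :
    Nat.card (Row (fun w => ∀ j, ¬ D (w j) (s j)) B) =
      Nat.card (PermsAvoiding fun x y : B => D x y) := by
  have key : ∀ τ : PermsAvoiding fun x y : B => D x y,
      Function.Injective (fun j => (τ.1.symm (s j) : P)) ∧
      univ.image (fun j => (τ.1.symm (s j) : P)) = B ∧ ∀ j, ¬ D (τ.1.symm (s j)) (s j) := by
    refine fun τ => ⟨Subtype.val_injective.comp (τ.1.symm.injective.comp s.injective), ?_,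
      fun j => by simpa using τ.2 (τ.1.symm (s j))⟩
    ext x
    rw [mem_image]
    exact ⟨fun ⟨j, _, h⟩ => h ▸ Subtype.coe_prop _, fun hx =>
      ⟨s.symm (τ.1 ⟨x, hx⟩), mem_univ _, by simp⟩⟩
  -- The row `w` corresponds to the permutation sending each `w j` to `s j`.
  refine (Nat.card_congr (Equiv.ofBijective
    (fun τ => ⟨fun j => (τ.1.symm (s j) : P), key τ⟩) ⟨?_, ?_⟩)).symm
  · intro τ τ' h
    refine Subtype.ext (Equiv.symm_bijective.injective (Equiv.ext fun x => ?_))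
    have := congrFun (Subtype.mk.inj h) (s.symm x)
    simpa using Subtype.ext this
  · rintro ⟨w, hw, hwB, hwD⟩
    have hmem : ∀ j, w j ∈ B := fun j => hwB ▸ mem_image_of_mem w (mem_univ j)
    let e : Fin k ≃ B := Equiv.ofBijective (fun j => ⟨w j, hmem j⟩)
      ⟨fun i j h => hw (Subtype.mk.inj h), fun ⟨x, hx⟩ => by
        obtain ⟨j, -, hj⟩ := mem_image.1 (hwB ▸ hx)
        exact ⟨j, Subtype.ext hj⟩⟩
    refine ⟨⟨e.symm.trans s, fun x => ?_⟩, Subtype.ext (funext fun j => ?_)⟩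
    · have h := hwD (e.symm x)
      have h' : w (e.symm x) = x := congrArg Subtype.val (e.apply_symm_apply x)
      rwa [h'] at h
    · change ((e (s.symm (s j)) : B) : P) = w j
      rw [s.symm_apply_apply]
      rfl

/-- The rows avoiding excedances with respect to any listing of their entries are equinumerous
with the rows avoiding descents. -/
theorem natCard_row_not_gt [PartialOrder P] [Fintype P] {k : ℕ} {B : Finset P} (s : Fin k ≃ B) :
    (Nat.card (Row (fun w : Fin k → P => ∀ j, ¬ w j > s j) B) : ℚ) = numDescentFree B := by
  rw [natCard_row_listing (fun a b : P => a > b) s, numDescentFree, card_words_eq]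
  obtain ⟨e⟩ := nonempty_wordsAvoiding_equiv_permsAvoiding _ (↥B) rfl
    -- The rank of an element is the number of elements of `P` strictly below it.
    (fun x y : B => (x : P) > y) ⟨fun x => #{y : P | y < x}, fun x y h => card_lt_card (by
      refine (ssubset_iff_of_subset fun z hz => ?_).2 ⟨y, by simpa using h, by simp⟩
      simp only [mem_filter, mem_univ, true_and] at hz ⊢
      exact hz.trans h)⟩
  rw [Nat.card_congr e]

end Rows

/-! ### Sums over ordered set partitions -/

section Partitions

variable {V : Type*} [Fintype V]

theorem natCard_sigma_ordPartition {L : List ℕ} {X : Fin L.length → Finset V → Type*}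
    [∀ i B, Finite (X i B)] {f : Finset V → ℚ}
    (hf : ∀ i B, B.card = L.get i → (Nat.card (X i B) : ℚ) = f B) :
    (Nat.card (Σ I : {I : Fin L.length → Finset V // IsOrdPartition L univ I},
      ∀ i, X i (I.1 i)) : ℚ) = ordSum f L univ := by
  rw [Nat.card_sigma, ordSum_eq_sum, ← sum_filter, Nat.cast_sum]
  rw [sum_subtype (p := IsOrdPartition L univ) _ (by simp)]
  refine sum_congr rfl fun I _ => ?_
  rw [Nat.card_pi, Nat.cast_prod]
  exact prod_congr rfl fun i _ => hf i _ (I.2.1 i)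

/-- A filling amounts to the ordered partition formed by its row sets with an arrangement of each
row, so row conditions contribute independent factors. -/
theorem natCard_fillings {L : List ℕ} {p : ∀ i : Fin L.length, (Fin (L.get i) → V) → Prop}
    {f : Finset V → ℚ} (hf : ∀ i B, B.card = L.get i → (Nat.card (Row (p i) B) : ℚ) = f B) :
    (Nat.card {U : (Σ i : Fin L.length, Fin (L.get i)) ≃ V // ∀ i, p i fun j => U ⟨i, j⟩} : ℚ) =
      ordSum f L univ := by
  rw [← natCard_sigma_ordPartition hf, Nat.cast_inj]
  have hmem : ∀ (I : {I : Fin L.length → Finset V // IsOrdPartition L univ I})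
      (w : ∀ i, Row (p i) (I.1 i)) i j, (w i).1 j ∈ I.1 i := fun I w i j =>
    (Finset.ext_iff.1 (w i).2.2.1 _).1 (mem_image_of_mem (w i).1 (mem_univ j))
  have key : ∀ x : Σ I : {I : Fin L.length → Finset V // IsOrdPartition L univ I},
      ∀ i, Row (p i) (I.1 i), Function.Bijective
        fun b : Σ i : Fin L.length, Fin (L.get i) => (x.2 b.1).1 b.2 := by
    refine fun x => ⟨?_, ?_⟩
    rotate_left
    · intro v
      obtain ⟨i, hi⟩ := (x.1.2.2.2 v).1 (mem_univ v)
      rw [← (x.2 i).2.2.1] at hi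
      obtain ⟨j, -, hj⟩ := mem_image.1 hi
      exact ⟨⟨i, j⟩, hj⟩
    rintro ⟨i, j⟩ ⟨i', j'⟩ h
    obtain rfl : i = i' := by
      by_contra hne
      refine disjoint_left.1 (x.1.2.2.1 i i' hne) (hmem x.1 x.2 i j) ?_
      exact (show (x.2 i).1 j = (x.2 i').1 j' from h) ▸ hmem x.1 x.2 i' j'
    exact congrArg (Sigma.mk i) ((x.2 i).2.1 h)
  refine (Nat.card_congr (Equiv.ofBijective
    (fun x => ⟨Equiv.ofBijective _ (key x), fun i => (x.2 i).2.2.2⟩) ⟨?_, ?_⟩)).symm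
  · rintro ⟨⟨I, hI⟩, w⟩ ⟨⟨I', hI'⟩, w'⟩ h
    have hw : ∀ i, (w i).1 = (w' i).1 := fun i => funext fun j =>
      congrArg (fun U : (Σ i : Fin L.length, Fin (L.get i)) ≃ V => U ⟨i, j⟩) (Subtype.mk.inj h)
    obtain rfl : I = I' := funext fun i => by
      have h₁ := (w i).2.2.1
      rw [hw i] at h₁
      exact h₁.symm.trans (w' i).2.2.1
    rw [show w = w' from funext fun i => Subtype.ext (hw i)]
  · rintro ⟨U, hU⟩
    refine ⟨⟨⟨fun i => univ.image fun j => U ⟨i, j⟩, fun i => ?_, fun i i' hne => ?_, fun v => ?_⟩,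
      fun i => ⟨fun j => U ⟨i, j⟩, fun j j' h => ?_, rfl, hU i⟩⟩, Subtype.ext (Equiv.ext fun b => rfl)⟩
    · rw [card_image_of_injective _ fun j j' h => by simpa using h, card_univ, Fintype.card_fin]
    · rw [disjoint_left]
      intro v hv hv'
      obtain ⟨j, -, rfl⟩ := mem_image.1 hv
      obtain ⟨j', -, h⟩ := mem_image.1 hv'
      exact hne (Sigma.mk.inj_iff.1 (U.injective h)).1.symm
    · refine ⟨fun _ => ⟨(U.symm v).1, mem_image.2 ⟨(U.symm v).2, mem_univ _, ?_⟩⟩,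
        fun _ => mem_univ _⟩
      exact U.apply_symm_apply v
    · simpa using h

end Partitions

section Tableaux

variable {P : Type*} [PartialOrder P] [Fintype P] {n : ℕ}

theorem natCard_descentFree (lam : n.Partition) :
    (Nat.card {U : Tableau P lam // DescentFree U} : ℚ) =
      ordSum numDescentFree (rows lam).blocks (univ : Finset P) :=
  natCard_fillings (L := (rows lam).blocks)
    (p := fun i w => ∀ j j' : Fin ((rows lam).blocks.get i), (j' : ℕ) = j + 1 → ¬ w j > w j')
    fun _ _ hB => congrArg Nat.cast (natCard_row_chain (fun a b : P => a > b) hB)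

theorem natCard_excedanceFree (label : P ≃ Fin n) (lam : n.Partition) :
    (Nat.card {U : Tableau P lam // ExcedanceFree label U} : ℚ) =
      ordSum numDescentFree (rows lam).blocks (univ : Finset P) := by
  -- The cardinality is part of `p` because `p` concerns arbitrary sequences, injective or not,
  -- while `orderEmbOfFin` needs the exact size.
  let p (i : Fin (rows lam).blocks.length) (w : Fin ((rows lam).blocks.get i) → P) : Prop :=
    ∃ h : (univ.image fun j => label (w j)).card = (rows lam).blocks.get i,
      ∀ j, ¬ w j > label.symm ((univ.image fun j => label (w j)).orderEmbOfFin h j)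
  have hp : ∀ i B, B.card = (rows lam).blocks.get i →
      (Nat.card (Row (p i) B) : ℚ) = numDescentFree B := by
    intro i B hB
    have hB' : (B.image label).card = (rows lam).blocks.get i := by
      rw [card_image_of_injective _ label.injective, hB]
    -- The listing by increasing labels depends only on the set `B` of entries, so it is one fixed
    -- listing for all arrangements of the row.
    let s : Fin ((rows lam).blocks.get i) ≃ B :=
      ((B.image label).orderIsoOfFin hB').toEquiv.trans
        (label.symm.subtypeEquiv fun a => by
          rw [mem_image]
          exact ⟨fun ⟨b, hb, h⟩ => h ▸ (label.symm_apply_apply b).symm ▸ hb,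
            fun h => ⟨_, h, label.apply_symm_apply a⟩⟩)
    rw [← natCard_row_not_gt s]
    congr 1
    refine Nat.card_congr (Equiv.subtypeEquivRight fun w => and_congr_right fun _ =>
      and_congr_right fun hw => ?_)
    have hw' : (univ.image fun j => label (w j)) = B.image label := by
      rw [← hw, image_image]
      rfl
    simp only [p]
    simp only [hw']
    exact ⟨fun ⟨_, h⟩ => h, fun h => ⟨hB', h⟩⟩
  rw [← natCard_fillings hp]
  congr 1
  exact Nat.card_congr (Equiv.subtypeEquivRight fun U => forall_congr' fun i =>
    ⟨fun h => ⟨card_rowLabels label U i, h⟩, fun ⟨_, h⟩ => h⟩)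

theorem natCard_orientedSubgraphPartition {V : Type*} [Fintype V] (G : SimpleGraph V)
    (lam : n.Partition) :
    (Nat.card (OrientedSubgraphPartition G lam) : ℚ) =
      ordSum (numAcyclic G) (rows lam).blocks (univ : Finset V) := by
  have : ∀ B : Finset V, Finite (AcyclicOrientation (G.induce (B : Set V))) := fun B =>
    Finite.of_injective (fun O => O.1.Adj) fun O O' h => Subtype.ext (Digraph.ext h)
  rw [← natCard_sigma_ordPartition (L := (rows lam).blocks)
    (X := fun _ B => AcyclicOrientation (G.induce (B : Set V)))
    fun i B _ => natCard_acyclicOrientation G B]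
  congr 1
  refine Nat.card_congr (Equiv.sigmaCongrLeft' (Equiv.subtypeEquivRight fun I =>
    and_congr_right fun _ => and_congr_right fun _ => ?_))
  simp

end Tableaux

end ChromTrace
end

noncomputable section
open scoped Classical
open Finset
namespace ChromTrace

/-! ### Chromatic symmetric functions as generating functions of group algebra elements -/

section Existence

variable {V : Type*} [Fintype V]

/-- Constancy of a function along the edges of a relation is invariance under a permutation. -/
theorem exists_perm_comp_eq_iff (R : V → V → Prop) :
    ∃ w : Equiv.Perm V, ∀ κ : V → ℕ, κ ∘ w = κ ↔ ∀ a b, R a b → κ a = κ b := by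
  let cls (v : V) : Finset V := {x | Relation.EqvGen R v x}
  have hmem : ∀ {v x}, x ∈ cls v ↔ Relation.EqvGen R v x := by simp [cls]
  have hcls : ∀ {v x}, Relation.EqvGen R v x → cls v = cls x := fun {v x} h => by
    ext y
    rw [hmem, hmem]
    exact ⟨fun h' => (h.symm).trans _ _ _ h', fun h' => h.trans _ _ _ h'⟩
  choose f hf using fun s : Finset V => exists_cycleOn s
  have hstep : ∀ v, Relation.EqvGen R v (f (cls v) v) := fun v =>
    hmem.1 ((hf (cls v)).1.1.1 (mem_coe.2 (hmem.2 (.refl v))))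
  have hinj : Function.Injective fun v => f (cls v) v := by
    intro v v' h
    have h' : cls v = cls v' := by
      rw [hcls (hstep v), hcls (hstep v')]
      exact congrArg cls h
    refine (f (cls v)).injective ?_
    change f (cls v) v = f (cls v') v' at h
    rw [h, h']
  let w : Equiv.Perm V := Equiv.ofBijective _ (Finite.injective_iff_bijective.1 hinj)
  have hw : ∀ v, w v = f (cls v) v := fun v => rfl
  refine ⟨w, fun κ => ⟨fun h a b hab => ?_, fun h => funext fun v => ?_⟩⟩
  · have hab' : Relation.EqvGen R a b := .rel _ _ hab
    obtain ⟨k, -, hk⟩ := (hf (cls a)).1.exists_pow_eq (hmem.2 (.refl a)) (hmem.2 hab')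
    have key : ∀ k, κ ((f (cls a) ^ k) a) = κ a ∧ Relation.EqvGen R a ((f (cls a) ^ k) a) := by
      intro k
      induction k with
      | zero => exact ⟨rfl, .refl a⟩
      | succ k ih =>
        have : (f (cls a) ^ (k + 1)) a = w ((f (cls a) ^ k) a) := by
          rw [hw, ← hcls ih.2, pow_succ', Equiv.Perm.mul_apply]
        rw [this]
        refine ⟨(congrFun h _).trans ih.1, ih.2.trans _ _ _ ?_⟩
        rw [hw]
        exact hstep _
    rw [← hk, (key k).1]
  · have : ∀ a b, Relation.EqvGen R a b → κ a = κ b := by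
      intro a b hab
      induction hab with
      | rel a b hab => exact h a b hab
      | refl => rfl
      | symm _ _ _ ih => exact ih.symm
      | trans _ _ _ _ _ ih ih' => exact ih.trans ih'
    exact (this _ _ (hstep v)).symm

/-- The indicator of proper colorings is a combination of indicators of invariant colorings. -/
theorem exists_indicator_proper_eq (G : SimpleGraph V) : ∃ a : Equiv.Perm V → ℚ, ∀ κ : V → ℕ,
    (if ∀ v v', G.Adj v v' → κ v ≠ κ v' then (1 : ℚ) else 0) =
      ∑ w, a w * if κ ∘ w = κ then 1 else 0 := by
  choose W hW using fun S : Finset (V × V) => exists_perm_comp_eq_iff fun v v' => (v, v') ∈ S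
  let E : Finset (V × V) := {p | G.Adj p.1 p.2}
  refine ⟨fun w => ∑ S ∈ E.powerset, if W S = w then (-1) ^ #S else 0, fun κ => ?_⟩
  -- Inclusion–exclusion over edges: expanding the product gives, for each set `S` of edges, the
  -- indicator of constancy along `S`, that is, of invariance under `W S`.
  have h1 : (if ∀ v v', G.Adj v v' → κ v ≠ κ v' then (1 : ℚ) else 0) =
      ∏ p ∈ E, (1 + -(if κ p.1 = κ p.2 then (1 : ℚ) else 0)) := by
    split_ifs with h
    · refine (prod_eq_one fun p hp => ?_).symm
      rw [if_neg (h _ _ (mem_filter.1 hp).2), neg_zero, add_zero]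
    · push Not at h
      obtain ⟨v, v', hv, hκ⟩ := h
      refine (prod_eq_zero (i := (v, v')) (by simpa [E] using hv) ?_).symm
      rw [if_pos hκ, add_neg_cancel]
  rw [h1, prod_one_add]
  simp_rw [sum_mul]
  rw [sum_comm]
  refine sum_congr rfl fun S _ => ?_
  rw [sum_eq_single (W S) (fun w _ hw => by rw [if_neg hw.symm, zero_mul])
    fun h => absurd (mem_univ _) h, if_pos rfl, prod_neg]
  congr 1
  by_cases h : κ ∘ W S = κ
  · rw [if_pos h]
    exact prod_eq_one fun p hp => if_pos ((hW S κ).1 h _ _ hp)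
  · rw [if_neg h]
    rw [hW] at h
    push Not at h
    obtain ⟨v, v', hv, hκ⟩ := h
    exact prod_eq_zero hv (if_neg hκ)

theorem exists_chromSymm_eq (G : SimpleGraph V) : ∃ a : Equiv.Perm V → ℚ,
    chromSymm G = ∑ w, a w • colorSeries fun κ : V → ℕ => κ ∘ w = κ := by
  obtain ⟨a, ha⟩ := exists_indicator_proper_eq G
  refine ⟨a, ?_⟩
  ext d
  rw [chromSymm_eq_colorSeries, map_sum, coeff_eq_apply, colorSeries]
  refine (sum_congr rfl fun κ _ => Eq.trans (by congr!) (ha κ)).trans ?_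
  rw [sum_comm]
  refine sum_congr rfl fun w _ => ?_
  rw [MvPowerSeries.coeff_smul, coeff_eq_apply, colorSeries, mul_sum]
  congr!

theorem colorSeries_comp_equiv {W : Type*} [Fintype W] (e : V ≃ W) (φ : (V → ℕ) → Prop) :
    colorSeries (fun κ : W → ℕ => φ (κ ∘ e)) = colorSeries φ := by
  ext d
  rw [coeff_eq_apply, coeff_eq_apply, colorSeries_apply, colorSeries_apply]
  congr 1
  refine Nat.card_congr ((e.symm.arrowCongr (Equiv.refl ℕ)).subtypeEquiv fun κ => ?_)
  have : content (κ ∘ e) = content κ := e.sum_comp fun v => Finsupp.single (κ v) 1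
  change _ ↔ content (κ ∘ e) = d ∧ φ (κ ∘ e)
  rw [this]

theorem colorSeries_permCongr {W : Type*} [Fintype W] (e : V ≃ W) (w : Equiv.Perm W) :
    (colorSeries fun κ : V → ℕ => κ ∘ e.symm.permCongr w = κ) =
      colorSeries fun κ : W → ℕ => κ ∘ w = κ := by
  rw [← colorSeries_comp_equiv e]
  congr 1
  ext κ
  constructor
  · intro h
    ext v
    simpa using congrFun h (e.symm v)
  · intro h
    ext v
    simpa using congrFun h (e v)

theorem exists_genY_eq_chromSymm {n : ℕ} (label : V ≃ Fin n) (G : SimpleGraph V) :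
    ∃ g : MonoidAlgebra ℚ (Equiv.Perm (Fin n)), genY g = chromSymm G := by
  obtain ⟨a, ha⟩ := exists_chromSymm_eq G
  -- The extra sign cancels the one that `genY_eq` introduces.
  refine ⟨.ofCoeff (Finsupp.equivFunOnFinite.symm fun w =>
    a (label.symm.permCongr w) * (Equiv.Perm.sign w : ℤ)), ?_⟩
  rw [genY_eq, ha, ← label.symm.permCongr.sum_comp]
  refine sum_congr rfl fun w _ => ?_
  rw [colorSeries_permCongr, MonoidAlgebra.coeff_ofCoeff, Finsupp.equivFunOnFinite_symm_apply_apply,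
    mul_assoc, ← Int.cast_mul, Int.units_coe_mul_self, Int.cast_one, mul_one]

end Existence

/-! ### The evaluation of induced trivial characters -/

section Evaluation

variable {n : ℕ}

theorem map_support_toFinsupp_rows (lam : n.Partition) :
    (rows lam).blocks.toFinsupp.support.val.map (rows lam).blocks.toFinsupp = lam.parts := by
  have h : (rows lam).blocks.toFinsupp.support = range (rows lam).blocks.length := by
    rw [List.toFinsupp_support, filter_eq_self]
    intro i hi
    rw [List.getD_eq_getElem _ _ (mem_range.1 hi)]
    exact ((rows lam).blocks_pos (List.getElem_mem _)).ne'
  rw [h, ← Multiset.sort_eq lam.parts (· ≥ ·)]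
  change ((List.range _ : Multiset ℕ)).map _ = ((rows lam).blocks : Multiset ℕ)
  rw [Multiset.map_coe]
  congr 1
  refine List.ext_getElem (by simp) fun i h₁ h₂ => ?_
  simp [h₂]

/-- If `Y(g)` is the chromatic symmetric function of `G`, then the values of the induced trivial
characters at `g` count ordered set partitions weighted by the signed inverse of the indicator of
independent sets. -/
theorem evalTrace_inducedTrivial_eq_ordSum {V : Type*} [Fintype V] (label : V ≃ Fin n)
    {G : SimpleGraph V} {f : Finset V → ℚ}
    (hf : SignedInverse (fun A => if IsIndep G A then 1 else 0) f)
    {g : MonoidAlgebra ℚ (Equiv.Perm (Fin n))} (hg : genY g = chromSymm G) (lam : n.Partition) :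
    evalTrace (inducedTrivial lam) g = ordSum f (rows lam).blocks univ := by
  obtain ⟨c, hc⟩ := exists_ordSum_eq_linearCombination V (rows lam).blocks
  let u (w : Equiv.Perm (Fin n)) (A : Finset V) : ℚ :=
    if IsInvariant (label.symm.permCongr w) A then 1 else 0
  have hu : ∀ (w : Equiv.Perm (Fin n)) α, (colorSeries fun κ : Fin n → ℕ => κ ∘ w = κ) α.toFinsupp =
      ordSum (u w) α univ := by
    intro w α
    rw [← colorSeries_permCongr label w, ← colorSeries_toFinsupp]
    · congr 2
      ext κ
      exact comp_eq_self_iff_isInvariant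
    · exact fun x => by simp
  -- This compares the coefficients of `x^α` in `Y(g) = X_G`.
  have hG : ∀ α : List ℕ, ordSum (fun A => if IsIndep G A then (1 : ℚ) else 0) α univ =
      ∑ w, (g.coeff w * (Equiv.Perm.sign w : ℤ)) * ordSum (u w) α univ := by
    intro α
    have h := congrArg (MvPowerSeries.coeff α.toFinsupp) hg
    rw [genY_eq, map_sum, chromSymm_eq_colorSeries, coeff_eq_apply] at h
    refine Eq.trans ?_ (h.symm.trans (sum_congr rfl fun w _ => ?_))
    · rw [← colorSeries_toFinsupp]
      · congr 2
        ext κ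
        simp only [IsIndep, mem_filter, mem_univ, true_and]
        exact ⟨fun h a b hab e => h _ a e b rfl hab, fun h i a ha b hb hab =>
          h a b hab (ha.trans hb.symm)⟩
      · exact fun a ha => absurd ha (notMem_empty a)
    · rw [MvPowerSeries.coeff_smul, coeff_eq_apply, hu]
  rw [hc _ _ hf, Finsupp.linearCombination_apply, Finsupp.sum, evalTrace]
  simp_rw [hG, smul_eq_mul, mul_sum]
  rw [sum_comm]
  refine sum_congr rfl fun w _ => ?_
  rw [inducedTrivial_eq (map_support_toFinsupp_rows lam), hu]
  -- The coefficients `c` that serve the graph serve each `w` too; there they produce `sign w`,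
  -- which cancels the sign in `Y(g)`.
  have h := hc _ _ (signedInverse_isInvariant (label.symm.permCongr w)) univ
  rw [ordSum_invariantSign, Equiv.Perm.sign_permCongr, Finsupp.linearCombination_apply,
    Finsupp.sum] at h
  have hs : ((Equiv.Perm.sign w : ℤ) : ℚ) * (Equiv.Perm.sign w : ℤ) = 1 := by
    rw [← Int.cast_mul, Int.units_coe_mul_self, Int.cast_one]
  have h' : ordSum (u w) (rows lam).blocks univ =
      (Equiv.Perm.sign w : ℤ) * ∑ α ∈ c.support, c α • ordSum (u w) α univ := by
    rw [← h, ← mul_assoc, hs, one_mul]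
  rw [h', mul_sum, mul_sum]
  refine sum_congr rfl fun α _ => ?_
  rw [smul_eq_mul]
  ring

end Evaluation

end ChromTrace
end

/-! ### The main theorem -/

theorem theoremt {P : Type*} [PartialOrder P] [Fintype P] {n : ℕ} (label : P ≃ Fin n)
    (lam : n.Partition) :
    -- the evaluation of `η^lam` at the graph `inc P` is the common value of `η^lam(g)` for the
    -- elements `g ∈ ℚ[S_n]` with `Y(g) = X_{inc P}`, and such elements exist
    (∃ g : MonoidAlgebra ℚ (Equiv.Perm (Fin n)),
      ChromTrace.genY g = ChromTrace.chromSymm (ChromTrace.inc P)) ∧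
    (∀ g : MonoidAlgebra ℚ (Equiv.Perm (Fin n)),
      ChromTrace.genY g = ChromTrace.chromSymm (ChromTrace.inc P) →
      ChromTrace.evalTrace (ChromTrace.inducedTrivial lam) g =
          (Nat.card {U : ChromTrace.Tableau P lam // ChromTrace.DescentFree U} : ℚ) ∧
      ChromTrace.evalTrace (ChromTrace.inducedTrivial lam) g =
          (Nat.card {U : ChromTrace.Tableau P lam // ChromTrace.ExcedanceFree label U} : ℚ) ∧
      ChromTrace.evalTrace (ChromTrace.inducedTrivial lam) g =
          (Nat.card (ChromTrace.OrientedSubgraphPartition (ChromTrace.inc P) lam) : ℚ)) ∧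
    -- the same number is the coefficient of `m_lam` in `ω X_{inc P}`
    (∃ F, ChromTrace.IsOmega (ChromTrace.chromSymm (ChromTrace.inc P)) F) ∧
    (∀ F, ChromTrace.IsOmega (ChromTrace.chromSymm (ChromTrace.inc P)) F →
      ∃ a : n.Partition → ℚ, F = ∑ mu : n.Partition, a mu • ChromTrace.mono mu ∧
        a lam = (Nat.card {U : ChromTrace.Tableau P lam // ChromTrace.DescentFree U} : ℚ)) := by
  have heval := fun g (hg : ChromTrace.genY g = ChromTrace.chromSymm (ChromTrace.inc P)) =>
    (ChromTrace.evalTrace_inducedTrivial_eq_ordSum label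
      ChromTrace.signedInverse_numDescentFree hg lam).trans
      (ChromTrace.natCard_descentFree lam).symm
  obtain ⟨g₀, hg₀⟩ := ChromTrace.exists_genY_eq_chromSymm label (ChromTrace.inc P)
  -- One `g₀` suffices for `ω`: it expands `ω X` with coefficients `η^mu(g₀)`, and `ω X` is unique.
  have homega := hg₀ ▸ ChromTrace.isOmega_genY g₀
  refine ⟨⟨g₀, hg₀⟩, fun g hg => ⟨heval g hg, ?_, ?_⟩, ⟨_, homega⟩, fun F hF =>
    ⟨_, ChromTrace.IsOmega.unique hF homega, heval g₀ hg₀⟩⟩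
  · rw [heval g hg, ChromTrace.natCard_descentFree, ChromTrace.natCard_excedanceFree]
  · rw [ChromTrace.natCard_orientedSubgraphPartition]
    exact ChromTrace.evalTrace_inducedTrivial_eq_ordSum label
      (ChromTrace.signedInverse_numAcyclic _) hg lam
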